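/- Let $\sigma$ be the surface measure on the unit sphere $S^2\subset\mathbb R^3$, so $\sigma(S^2)=4\pi$. A spherical harmonic of degree $\ell$ is the restriction to $S^2$ of a (complex) homogeneous harmonic polynomial of degree $\ell$ on $\mathbb R^3$; $V_L$ denotes the linear span of all spherical harmonics of degrees $0,\dots,L$. For $f\in C^2(S^2)$ put $$\|f\|_{C^2(S^2)}=\max\Big(\sup_{S^2}|f|,\ \sup_{S^2}|\nabla f|,\ \sup_{S^2}|\nabla^2 f|\Big),$$ where $\nabla f$ and $\nabla^2 f$ are the gradient and the covariant Hessian for the round metric and $|\cdot|$ is the operator norm on tangent planes. Let $L\ge 1$ be an integer and let $f$ be a real-valued function in $V_L\cap C^2(S^2)$. Let $\omega_1,\dots,\omega_M\in S^2$ and $w_1,\dots,w_M\in\mathbb R$ be a quadrature rule that is exact up to degree $2L$: $$\int_{S^2}P\,d\sigma=\sum_{j=1}^M w_jP(\omega_j)\qquad\text{for all }P\in V_{2L}.$$ Let $\{Y_\ell^m\}_{0\le\ell\le L,\,-\ell\le m\le\ell}$ be the standard orthonormal basis of $V_L$ in $L^2(S^2)$, $$Y_\ell^m=(-1)^m\sqrt{\tfrac{2\ell+1}{4\pi}\tfrac{(\ell-m)!}{(\ell+m)!}}\;\sin^m\theta\;P_\ell^{(m)}(\cos\theta)\,e^{im\varphi}\quad(0\le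 m\le\ell),\qquad Y_\ell^{-m}=(-1)^m\overline{Y_\ell^m},$$ with $P_\ell$ the Legendre polynomial; or, more generally, any orthonormal family (real or complex) such that for each $\ell\le L$ the $Y_\ell^m$, $|m|\le\ell$, span the spherical harmonics of degree $\ell$. (The displayed standard functions are such a family.) Set $g(j)=f(\omega_j)$ and, for $0\le\ell\le L$, $-\ell\le m\le\ell$, $$\widehat g(\ell,m)=\sum_{j=1}^M w_j\,g(j)\,Y_\ell^m(\omega_j),\qquad \widehat f(\ell,m)=\int_{S^2}f\,Y_\ell^m\,d\sigma .$$ Then $fY_\ell^m\in V_{2L}$ and $\widehat g(\ell,m)=\widehat f(\ell,m)$ for all $0\le\ell\le L$, $-\ell\le m\le\ell$, and $$\sum_{\ell=0}^L\sum_{m=-\ell}^{\ell}|\widehat g(\ell,m)|^2=\sum_{\ell=0}^L\sum_{m=-\ell}^{\ell}|\widehat f(\ell,m)|^2=\|f\|_{L^2(S^2)}^2,\qquad \sum_{j=1}^M w_j|g(j)|^2=\|f\|_{L^2(S^2)}^2 .$$ If $f$ is not identically zero, then with $\ell^1$ and $\ell^2$ norms taken over the indices $0\le\ell\le L$, $-\ell\le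 m\le\ell$, and $C_0=48\sqrt\pi$, the Fourier ratio $FR_L(f)=\|\widehat f\|_1/\|\widehat f\|_2$ satisfies $$FR_L(f)=\frac{\|\widehat g\|_1}{\|\widehat g\|_2},\qquad FR_L(f)\le\frac{\left|\int_{S^2}f\,d\sigma\right|}{\|f\|_{L^2(S^2)}}+C_0\frac{\|f\|_{C^2(S^2)}}{\|f\|_{L^2(S^2)}}\log L+C_0\frac{\|f\|_{C^2(S^2)}}{\|f\|_{L^2(S^2)}}\frac1L .$$ In particular, if $f\ge0$ and $\mu=\int_{S^2}f\,d\sigma>0$, then $$FR_L(f)\le\sqrt{4\pi}+C_0\sqrt{4\pi}\,\frac{\|f\|_{C^2(S^2)}}{\mu}\log L+C_0\sqrt{4\pi}\,\frac{\|f\|_{C^2(S^2)}}{\mu}\frac1L .$$ -/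

import Mathlib

open scoped Manifold ComplexConjugate
open MeasureTheory

noncomputable section

namespace SphereFR

/-- Three-dimensional Euclidean space. -/
abbrev R3 : Type := EuclideanSpace ℝ (Fin 3)

/-- The unit sphere `S²` of `ℝ³`. -/
abbrev S2 : Type := Metric.sphere (0 : R3) 1

/-- The surface measure of `S²` (of total mass `4π`). -/
abbrev σ : Measure S2 := (volume : Measure R3).toSphere

/-! ### Spherical harmonics -/

/-- The Laplacian `∂₁² + ∂₂² + ∂₃²` on complex polynomials in three variables. -/
def polyLaplacian : MvPolynomial (Fin 3) ℂ →ₗ[ℂ] MvPolynomial (Fin 3) ℂ :=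
  ∑ i : Fin 3, (MvPolynomial.pderiv i).toLinearMap ∘ₗ (MvPolynomial.pderiv i).toLinearMap

/-- Restriction of a polynomial in three variables to the sphere. -/
def restrictToSphere : MvPolynomial (Fin 3) ℂ →ₗ[ℂ] (S2 → ℂ) :=
  LinearMap.pi fun x : S2 =>
    (MvPolynomial.aeval fun i : Fin 3 => (((x : R3) i : ℝ) : ℂ)).toLinearMap

/-- The space of spherical harmonics of degree `ℓ`: restrictions to `S²` of the harmonic
polynomials that are homogeneous of degree `ℓ`. -/
def harmonics (l : ℕ) : Submodule ℂ (S2 → ℂ) :=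
  (MvPolynomial.homogeneousSubmodule (Fin 3) ℂ l ⊓ LinearMap.ker polyLaplacian).map
    restrictToSphere

/-- `V L` is the space `V_L` of spherical harmonics of degree at most `L`. -/
def V (L : ℕ) : Submodule ℂ (S2 → ℂ) := ⨆ l ∈ Finset.range (L + 1), harmonics l

/-- `Y l m`, for `0 ≤ l ≤ L` and `-l ≤ m ≤ l`, is an orthonormal basis of spherical harmonics:
the family is orthonormal in `L²(S²)`, and for each `l ≤ L` the functions `Y l m` with
`-l ≤ m ≤ l` span the spherical harmonics of degree `l`.
Values of `Y` at other indices are irrelevant. -/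
structure IsOrthonormalHarmonicBasis (L : ℕ) (Y : ℕ → ℤ → S2 → ℂ) : Prop where
  span_eq : ∀ l ≤ L, Submodule.span ℂ (Y l '' Set.Icc (-(l : ℤ)) l) = harmonics l
  orthonormal : ∀ l ≤ L, ∀ m ∈ Set.Icc (-(l : ℤ)) l, ∀ l' ≤ L, ∀ m' ∈ Set.Icc (-(l' : ℤ)) l',
    ∫ x, Y l m x * conj (Y l' m' x) ∂σ = if l = l' ∧ m = m' then 1 else 0

/-- The Legendre polynomial `P_ℓ`, by Rodrigues' formula. -/
def legendre (l : ℕ) : Polynomial ℝ :=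
  Polynomial.C (1 / (2 ^ l * (l.factorial : ℝ))) *
    (Polynomial.derivative^[l] ((Polynomial.X ^ 2 - 1) ^ l))

/-- The function
`√((2ℓ+1)/(4π) · (ℓ-k)!/(ℓ+k)!) · (sin θ)^k e^{ikφ} · P_ℓ^{(k)}(cos θ)`, for `0 ≤ k ≤ ℓ`, in terms
of `x = (sin θ cos φ, sin θ sin φ, cos θ)`. -/
def harmonicCore (l k : ℕ) (x : S2) : ℂ :=
  (√((2 * l + 1) / (4 * Real.pi) * ((l - k).factorial / (l + k).factorial : ℝ)) : ℝ) *
    (((x : R3) 0 : ℂ) + Complex.I * ((x : R3) 1 : ℂ)) ^ k *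
    (((Polynomial.derivative^[k] (legendre l)).eval ((x : R3) 2) : ℝ) : ℂ)

/-- The standard spherical harmonics
`Y_ℓ^m = √((2ℓ+1)/(4π) · (ℓ-m)!/(ℓ+m)!) · P_ℓ^m(cos θ) e^{imφ}` for `0 ≤ m ≤ ℓ`, where
`P_ℓ^m(t) = (-1)^m (1-t²)^{m/2} P_ℓ^{(m)}(t)`, and `Y_ℓ^{-m} = (-1)^m conj Y_ℓ^m`. -/
def standardY (l : ℕ) (m : ℤ) (x : S2) : ℂ :=
  if 0 ≤ m then (-1) ^ m.natAbs * harmonicCore l m.natAbs x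
  else conj (harmonicCore l m.natAbs x)

/-! ### Norms of functions on the sphere -/

/-- The norm of `L²(S²)`. -/
def L2norm (f : S2 → ℝ) : ℝ := √(∫ x, f x ^ 2 ∂σ)

/-- The extension of `f` to `ℝ³ \ {0}` that is constant on rays, `y ↦ f (y / |y|)`
(with value `0` at the origin). -/
def radialExt (f : S2 → ℝ) (y : R3) : ℝ :=
  if h : y ≠ 0 then f ⟨‖y‖⁻¹ • y, by simp [norm_smul, h]⟩ else 0

/-- The orthogonal projection of `ℝ³` onto the tangent plane `xᗮ` of `S²` at `x`. -/
def tangentProj (x : S2) : R3 →L[ℝ] R3 := (ℝ ∙ (x : R3))ᗮ.starProjection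

/-- The differential of `f` at `x`, a linear form on the tangent plane, precomposed with the
orthogonal projection onto that plane (which does not change its norm). -/
def sphDifferential (f : S2 → ℝ) (x : S2) : R3 →L[ℝ] ℝ :=
  (fderiv ℝ (radialExt f) (x : R3)).comp (tangentProj x)

/-- The covariant Hessian of `f` at `x`, a bilinear form on the tangent plane, precomposed in both
arguments with the orthogonal projection onto that plane (which does not change its norm).
It is the restriction to the tangent plane of the second derivative of the radial extension `F`:
along a unit speed great circle `γ` with `γ 0 = x`, `γ' 0 = v`, one has
`(f ∘ γ)'' 0 = D²F(x)(v, v) - DF(x)(x)`, and `DF(x)(x) = 0`. -/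
def sphHessian (f : S2 → ℝ) (x : S2) : R3 →L[ℝ] R3 →L[ℝ] ℝ :=
  (fderiv ℝ (fderiv ℝ (radialExt f)) (x : R3)).bilinearComp (tangentProj x) (tangentProj x)

/-- The norm of `C²(S²)`: the largest of the suprema over the sphere of `|f|`, `|∇f|`, `|∇²f|`
(operator norms with respect to the round metric). -/
def C2norm (f : S2 → ℝ) : ℝ :=
  max (⨆ x, |f x|) (max (⨆ x, ‖sphDifferential f x‖) (⨆ x, ‖sphHessian f x‖))

/-! ### Coefficients and the Fourier ratio -/

/-- The coefficients `∫ f Y_ℓ^m dσ`. -/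
def coeff (Y : ℕ → ℤ → S2 → ℂ) (f : S2 → ℝ) (l : ℕ) (m : ℤ) : ℂ :=
  ∫ x, (f x : ℂ) * Y l m x ∂σ

/-- The discrete coefficients `∑_j w_j g(j) Y_ℓ^m(ω_j)`. -/
def discreteCoeff (Y : ℕ → ℤ → S2 → ℂ) {M : ℕ} (ω : Fin M → S2) (w : Fin M → ℝ)
    (g : Fin M → ℝ) (l : ℕ) (m : ℤ) : ℂ :=
  ∑ j, (w j : ℂ) * (g j : ℂ) * Y l m (ω j)

/-- The `ℓ¹` norm of `c` over the indices `0 ≤ l ≤ L`, `-l ≤ m ≤ l`. -/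
def coeffL1 (L : ℕ) (c : ℕ → ℤ → ℂ) : ℝ :=
  ∑ l ∈ Finset.range (L + 1), ∑ m ∈ Finset.Icc (-(l : ℤ)) l, ‖c l m‖

/-- The sum of squares of `c` over the indices `0 ≤ l ≤ L`, `-l ≤ m ≤ l`. -/
def coeffSq (L : ℕ) (c : ℕ → ℤ → ℂ) : ℝ :=
  ∑ l ∈ Finset.range (L + 1), ∑ m ∈ Finset.Icc (-(l : ℤ)) l, ‖c l m‖ ^ 2

/-- The ratio `‖c‖₁ / ‖c‖₂` over the indices `0 ≤ l ≤ L`, `-l ≤ m ≤ l`. -/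
def fourierRatio (L : ℕ) (c : ℕ → ℤ → ℂ) : ℝ := coeffL1 L c / √(coeffSq L c)

end SphereFR

end

open SphereFR

noncomputable section

namespace SphereFR

/-! ### Polynomials on the sphere and their surface integral -/

open MvPolynomial (X C pderiv)

/-! The `ℓ¹` bound is Cauchy–Schwarz with the weights `l(l+1)`, the eigenvalues of `-Δ` on the
sphere. The degree-zero coefficient is at most `|∫ f|` in modulus, because `Y 0 0` is a constant of
modulus `1/√(4π)`. For the rest, `∑ (2l+1)/(l(l+1))²` telescopes to at most `1`, while `∑
(l(l+1))²|coeff|²` is `‖Δf‖₂²`. As `Δf` is the trace of the Hessian on a tangent plane, `|Δf| ≤ 2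
C2norm f`, so the second factor is at most `4√π · C2norm f` (`coeffL1_le`). This is stronger than
the claim, because `log L + 1/L ≥ 1`.

The discrete statements reduce to `f · Y l m` and `f²` lying in `V (2L)`, where the quadrature is
exact. That holds because every polynomial of degree at most `N` restricts to an element of `V N`
(`restrict_mem_V`).

All integrals come from one fact: infinitesimal rotations integrate to zero
(`sphereIntegral_rotDeriv`). With Euler's identity it yields Green's formula, hence orthogonality of
different degrees. It also makes the ladder operators skew, which gives the norms of the standard
harmonics; a dimension count shows that these span. -/

/-- Complex polynomials in three variables. -/
abbrev Poly : Type := MvPolynomial (Fin 3) ℂ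

/-- The value of a polynomial at a point of `ℝ³`. -/
def evalAt (y : R3) : Poly →ₐ[ℂ] ℂ := MvPolynomial.aeval fun i : Fin 3 => ((y i : ℝ) : ℂ)

theorem restrictToSphere_apply (p : Poly) (x : S2) : restrictToSphere p x = evalAt (x : R3) p := rfl

@[simp] theorem evalAt_X (y : R3) (i : Fin 3) : evalAt y (MvPolynomial.X i) = (y i : ℂ) := by
  simp [evalAt]

@[simp] theorem evalAt_C (y : R3) (c : ℂ) : evalAt y (MvPolynomial.C c) = c := by
  simp [evalAt]

theorem continuous_evalAt (p : Poly) : Continuous fun y : R3 => evalAt y p := by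
  induction p using MvPolynomial.induction_on with
  | C a => simpa using continuous_const
  | add p q hp hq =>
    simp only [map_add]
    exact hp.add hq
  | mul_X p i hp =>
    simp only [map_mul, evalAt_X]
    exact hp.mul (by fun_prop)

theorem hasDerivAt_evalAt {γ : ℝ → R3} {γ' : Fin 3 → ℝ} {t : ℝ}
    (h : ∀ i, HasDerivAt (fun s => γ s i) (γ' i) t) (p : Poly) :
    HasDerivAt (fun s => evalAt (γ s) p)
      (∑ i, (γ' i : ℂ) * evalAt (γ t) (MvPolynomial.pderiv i p)) t := by
  induction p using MvPolynomial.induction_on with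
  | C a => simpa using hasDerivAt_const t a
  | add p q hp hq =>
    simp only [map_add, mul_add, Finset.sum_add_distrib]
    exact hp.add hq
  | mul_X p j hp =>
    have hj : HasDerivAt (fun s => ((γ s j : ℝ) : ℂ)) (γ' j : ℂ) t := (h j).ofReal_comp
    have := hp.mul hj
    simp only [map_mul, evalAt_X]
    refine this.congr_deriv ?_
    simp only [Derivation.leibniz, MvPolynomial.pderiv_X, smul_eq_mul, map_add, map_mul, evalAt_X,
      mul_add, Finset.sum_add_distrib, Pi.single_apply, apply_ite (evalAt (γ t)), map_one, map_zero]
    simp only [mul_ite, mul_one, mul_zero, Finset.sum_ite_eq, Finset.mem_univ,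
      if_true, Finset.sum_mul]
    rw [add_comm, mul_comm (γ' j : ℂ)]
    congr 1
    exact Finset.sum_congr rfl fun i _ => by ring

theorem continuous_restrict (p : Poly) : Continuous (restrictToSphere p) :=
  (continuous_evalAt p).comp continuous_subtype_val

instance : IsFiniteMeasure σ := inferInstanceAs (IsFiniteMeasure (volume : Measure R3).toSphere)

theorem integrable_of_continuous {f : S2 → ℂ} (hf : Continuous f) : Integrable f σ :=
  hf.integrable_of_hasCompactSupport (HasCompactSupport.of_compactSpace f)

theorem sigma_univ : σ.real Set.univ = 4 * Real.pi := by
  rw [Measure.toSphere_real_apply_univ, measureReal_def, EuclideanSpace.volume_ball_fin_three]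
  rw [finrank_euclideanSpace_fin, ENNReal.ofReal_one, one_pow, one_mul,
    ENNReal.toReal_ofReal (by positivity)]
  ring

theorem sum_sq_sphere (x : S2) : (x : R3) 0 ^ 2 + (x : R3) 1 ^ 2 + (x : R3) 2 ^ 2 = 1 := by
  have h := x.2
  rw [mem_sphere_zero_iff_norm] at h
  have h2 := EuclideanSpace.real_norm_sq_eq (x : R3)
  rw [h, Fin.sum_univ_three] at h2
  linarith

/-- The integral over the sphere, as a linear form on polynomials. -/
def sphereIntegral : Poly →ₗ[ℂ] ℂ where
  toFun p := ∫ x, restrictToSphere p x ∂σ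
  map_add' p q := by
    simp only [map_add, Pi.add_apply]
    exact integral_add (integrable_of_continuous (continuous_restrict p))
      (integrable_of_continuous (continuous_restrict q))
  map_smul' c p := by
    simp only [map_smul, Pi.smul_apply, RingHom.id_apply]
    exact integral_smul c _

theorem sphereIntegral_apply (p : Poly) : sphereIntegral p = ∫ x, restrictToSphere p x ∂σ := rfl

theorem sphereIntegral_one : sphereIntegral 1 = 4 * Real.pi := by
  simp only [sphereIntegral_apply, restrictToSphere_apply, map_one, integral_const, sigma_univ]
  simp

theorem sphereIntegral_congr {p q : Poly} (h : restrictToSphere p = restrictToSphere q) :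
    sphereIntegral p = sphereIntegral q := by
  rw [sphereIntegral_apply, h]; rfl

/-- The polynomial `x² + y² + z²`. -/
def normSqPoly : Poly := ∑ i : Fin 3, MvPolynomial.X i ^ 2

theorem evalAt_normSqPoly (x : S2) : evalAt (x : R3) normSqPoly = 1 := by
  simp only [normSqPoly, Fin.sum_univ_three]
  simp only [map_add, map_pow, evalAt_X]
  have h := congrArg (fun r : ℝ => (r : ℂ)) (sum_sq_sphere x)
  push_cast at h
  exact h

theorem restrict_normSq_mul (p : Poly) :
    restrictToSphere (normSqPoly * p) = restrictToSphere p := by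
  ext x
  simp [restrictToSphere_apply, evalAt_normSqPoly]

/-! ### Rotation invariance -/

/-- A linear isometry of `ℝ³` acts on the unit sphere. -/
def sphereMap (e : R3 ≃ₗᵢ[ℝ] R3) (x : S2) : S2 :=
  ⟨e x, by simp [e.norm_map]⟩

theorem continuous_sphereMap (e : R3 ≃ₗᵢ[ℝ] R3) : Continuous (sphereMap e) :=
  (e.continuous.comp continuous_subtype_val).subtype_mk _

/-- The surface measure of `s` is a fixed multiple of the volume of the cone over `s`. The cone over
the preimage of `s` is the preimage of the cone, and linear isometries preserve volume. -/
theorem measurePreserving_sphereMap (e : R3 ≃ₗᵢ[ℝ] R3) : MeasurePreserving (sphereMap e) σ σ := by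
  refine ⟨(continuous_sphereMap e).measurable, Measure.ext fun s hs => ?_⟩
  rw [Measure.map_apply (continuous_sphereMap e).measurable hs, Measure.toSphere_apply' _ hs,
    Measure.toSphere_apply' _ ((continuous_sphereMap e).measurable hs)]
  congr 1
  refine Eq.trans ?_ (e.measurePreserving.measure_preimage_equiv
    (f := e.toHomeomorph.toMeasurableEquiv) _)
  congr 1
  ext y
  simp only [Set.mem_smul, Set.mem_image, Set.mem_preimage]
  constructor
  · rintro ⟨r, hr, -, ⟨x, hx, rfl⟩, rfl⟩
    exact ⟨r, hr, _, ⟨sphereMap e x, hx, rfl⟩, (map_smul e r (x : R3)).symm⟩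
  · rintro ⟨r, hr, -, ⟨x, hx, rfl⟩, h⟩
    refine ⟨r, hr, _, ⟨sphereMap e.symm x, ?_, rfl⟩, ?_⟩
    · have : sphereMap e (sphereMap e.symm x) = x := by ext; simp [sphereMap]
      simpa [this] using hx
    · apply e.injective
      rw [map_smul]
      simpa [sphereMap] using h

/-- The rotation by the angle `t` in the plane of the coordinates `i` and `j`. -/
def rotationFun (i j : Fin 3) (t : ℝ) (y : R3) : R3 :=
  WithLp.toLp 2 fun k => if k = i then Real.cos t * y i - Real.sin t * y j
    else if k = j then Real.sin t * y i + Real.cos t * y j else y k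

/-- `rotationFun` as a linear isometry. -/
def rotationIsometry (i j : Fin 3) (hij : i ≠ j) (t : ℝ) : R3 →ₗᵢ[ℝ] R3 where
  toFun := rotationFun i j t
  map_add' y z := by
    ext k; simp only [rotationFun, PiLp.add_apply]; split_ifs <;> ring
  map_smul' c y := by
    ext k; simp only [rotationFun, PiLp.smul_apply, smul_eq_mul, RingHom.id_apply]
    split_ifs <;> ring
  norm_map' y := by
    have h : ‖rotationFun i j t y‖ ^ 2 = ‖y‖ ^ 2 := by
      have hcs := Real.sin_sq_add_cos_sq t
      rw [EuclideanSpace.real_norm_sq_eq, EuclideanSpace.real_norm_sq_eq, Fin.sum_univ_three,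
        Fin.sum_univ_three]
      fin_cases i <;> fin_cases j <;> simp [rotationFun] at hij ⊢ <;>
        first
        | linear_combination (y 0 ^ 2 + y 1 ^ 2) * hcs
        | linear_combination (y 0 ^ 2 + y 2 ^ 2) * hcs
        | linear_combination (y 1 ^ 2 + y 2 ^ 2) * hcs
    exact (sq_eq_sq₀ (norm_nonneg _) (norm_nonneg _)).1 h

/-- `rotationFun` as a linear isometric equivalence. -/
def rotation (i j : Fin 3) (hij : i ≠ j) (t : ℝ) : R3 ≃ₗᵢ[ℝ] R3 :=
  (rotationIsometry i j hij t).toLinearIsometryEquiv rfl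

/-- The derivation `x_i ∂_j - x_j ∂_i`, the infinitesimal rotation. -/
def rotDeriv (i j : Fin 3) : Derivation ℂ Poly Poly :=
  (MvPolynomial.X i : Poly) • MvPolynomial.pderiv j -
    (MvPolynomial.X j : Poly) • MvPolynomial.pderiv i

theorem rotDeriv_apply (i j : Fin 3) (p : Poly) :
    rotDeriv i j p = MvPolynomial.X i * MvPolynomial.pderiv j p -
      MvPolynomial.X j * MvPolynomial.pderiv i p := rfl

theorem hasDerivAt_rotationFun {i j : Fin 3} (hij : i ≠ j) (y : R3) (t : ℝ) (k : Fin 3) :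
    HasDerivAt (fun s => rotationFun i j s y k) (if k = i then -rotationFun i j t y j
      else if k = j then rotationFun i j t y i else 0) t := by
  have h1 := ((Real.hasDerivAt_cos t).mul_const (y i)).sub
    ((Real.hasDerivAt_sin t).mul_const (y j))
  have h2 := ((Real.hasDerivAt_sin t).mul_const (y i)).add
    ((Real.hasDerivAt_cos t).mul_const (y j))
  simp only [rotationFun, if_true, if_neg hij.symm]
  split_ifs
  · exact h1.congr_deriv (by ring)
  · exact h2.congr_deriv (by ring)
  · exact hasDerivAt_const _ _

theorem hasDerivAt_evalAt_rotation {i j : Fin 3} (hij : i ≠ j) (p : Poly) (y : R3) (t : ℝ) :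
    HasDerivAt (fun s => evalAt (rotationFun i j s y) p)
      (evalAt (rotationFun i j t y) (rotDeriv i j p)) t := by
  have h := hasDerivAt_evalAt (γ := fun s => rotationFun i j s y) (t := t)
    (γ' := fun k => if k = i then -rotationFun i j t y j
      else if k = j then rotationFun i j t y i else 0) (hasDerivAt_rotationFun hij y t) p
  refine h.congr_deriv ?_
  rw [Fintype.sum_eq_add i j hij (fun k hk => by simp [hk.1, hk.2])]
  simp only [if_true, if_neg hij.symm, rotDeriv_apply, map_sub, map_mul, evalAt_X]
  push_cast
  ring

theorem continuous_rotationFun (i j : Fin 3) :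
    Continuous fun q : ℝ × R3 => rotationFun i j q.1 q.2 := by
  unfold rotationFun
  refine (PiLp.continuous_toLp 2 _).comp (continuous_pi fun k => ?_)
  split_ifs <;> fun_prop

theorem restrict_sphereMap_rotation {i j : Fin 3} (hij : i ≠ j) (q : Poly) (t : ℝ) (x : S2) :
    restrictToSphere q (sphereMap (rotation i j hij t) x) = evalAt (rotationFun i j t x) q := rfl

attribute [irreducible] rotationFun evalAt

theorem integral_rotationFun {i j : Fin 3} (hij : i ≠ j) (q : Poly) (t : ℝ) :
    ∫ x : S2, evalAt (rotationFun i j t x) q ∂σ = sphereIntegral q := by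
  have hmp := measurePreserving_sphereMap (rotation i j hij t)
  have h := integral_map (μ := σ) (φ := sphereMap (rotation i j hij t))
    (f := restrictToSphere q) hmp.measurable.aemeasurable
    (continuous_restrict q).aestronglyMeasurable
  rw [hmp.map_eq] at h
  simp_rw [restrict_sphereMap_rotation] at h
  rw [sphereIntegral_apply, h]

theorem continuous_evalAt_rotationFun (i j : Fin 3) (q : Poly) :
    Continuous fun a : ℝ × S2 => evalAt (rotationFun i j a.1 a.2) q :=
  have h1 : Continuous fun a : ℝ × S2 => ((a.1, (a.2 : R3)) : ℝ × R3) := by fun_prop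
  have h2 : Continuous fun a : ℝ × S2 => rotationFun i j a.1 a.2 :=
    (continuous_rotationFun i j).comp h1
  (continuous_evalAt q).comp h2

theorem integrable_uncurry_of_continuous {F : ℝ × S2 → ℂ} (hF : Continuous F) :
    Integrable F ((volume.restrict (Set.uIoc (0 : ℝ) 1)).prod σ) := by
  have h : IntegrableOn F (Set.uIoc (0 : ℝ) 1 ×ˢ Set.univ) (volume.prod σ) :=
    (hF.continuousOn.integrableOn_compact (isCompact_Icc.prod isCompact_univ)).mono_set
      (t := Set.Icc 0 1 ×ˢ Set.univ)
      (Set.prod_mono (by rw [Set.uIoc_of_le zero_le_one]; exact Set.Ioc_subset_Icc_self) le_rfl)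
  rwa [IntegrableOn, ← Measure.prod_restrict, Measure.restrict_univ] at h

/-- Integrate the derivative of `p` along the rotation flow over time in `[0, 1]` and over the
sphere. By rotation invariance the inner sphere integral does not depend on time. In the other
order, the fundamental theorem of calculus leaves the difference of two equal integrals. Fubini
replaces differentiation under the integral sign. -/
theorem sphereIntegral_rotDeriv (i j : Fin 3) (p : Poly) :
    sphereIntegral (rotDeriv i j p) = 0 := by
  by_cases hij : i = j
  · subst hij
    rw [rotDeriv_apply, sub_self, map_zero]
  have hc := continuous_evalAt_rotationFun i j
  have hl : ∀ (x : S2) (q : Poly), Continuous fun t : ℝ => evalAt (rotationFun i j t x) q :=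
    fun x q => (hc q).comp (Continuous.prodMk_left x)
  have h1 : ∫ t in (0 : ℝ)..1, ∫ x : S2, evalAt (rotationFun i j t x) (rotDeriv i j p) ∂σ =
      sphereIntegral (rotDeriv i j p) := by
    simp_rw [integral_rotationFun hij]
    simp
  have h2 : ∀ x : S2, ∫ t in (0 : ℝ)..1, evalAt (rotationFun i j t x) (rotDeriv i j p) =
      evalAt (rotationFun i j 1 x) p - evalAt (rotationFun i j 0 x) p := fun x =>
    intervalIntegral.integral_eq_sub_of_hasDerivAt
      (fun t _ => hasDerivAt_evalAt_rotation hij p x t)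
      ((hl x _).intervalIntegrable _ _)
  have h3 := intervalIntegral_integral_swap (μ := σ) (a := 0) (b := 1)
    (f := fun (t : ℝ) (x : S2) => evalAt (rotationFun i j t x) (rotDeriv i j p))
    (integrable_uncurry_of_continuous (hc (rotDeriv i j p)))
  have h4 : ∀ t : ℝ, Integrable (fun x : S2 => evalAt (rotationFun i j t x) p) σ := fun t =>
    integrable_of_continuous ((hc p).comp (Continuous.prodMk_right t))
  rw [← h1, h3]
  simp_rw [h2]
  rw [integral_sub (h4 1) (h4 0), integral_rotationFun hij, integral_rotationFun hij, sub_self]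

/-! ### Euler's identity, the Laplacian and Green's formula -/

theorem pderiv_comm (i j : Fin 3) (p : Poly) :
    pderiv i (pderiv j p) = pderiv j (pderiv i p) := by
  have h : ⁅(pderiv i : Derivation ℂ Poly Poly), (pderiv j : Derivation ℂ Poly Poly)⁆ = 0 := by
    refine MvPolynomial.derivation_ext fun k => ?_
    rw [Derivation.commutator_apply]
    simp [MvPolynomial.pderiv_X, Pi.single_apply, apply_ite (pderiv i : Poly → Poly),
      apply_ite (pderiv j : Poly → Poly)]
  have h2 := congrArg (fun D : Derivation ℂ Poly Poly => D p) h
  simp only [Derivation.commutator_apply] at h2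
  exact sub_eq_zero.1 h2

theorem polyLaplacian_apply (p : Poly) : polyLaplacian p = ∑ i, pderiv i (pderiv i p) := by
  simp [polyLaplacian]

/-- `p` satisfies Euler's identity with the (complex) degree `a`. -/
def IsEuler (a : ℂ) (p : Poly) : Prop := ∑ i, X i * pderiv i p = C a * p

theorem isEuler_of_isHomogeneous {p : Poly} {n : ℕ} (h : p.IsHomogeneous n) : IsEuler n p := by
  rw [IsEuler, h.sum_X_mul_pderiv]
  simp

theorem pderiv_X_eq (i j : Fin 3) : (pderiv i (X j : Poly)) = if i = j then 1 else 0 := by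
  rw [MvPolynomial.pderiv_X, Pi.single_apply]
  simp only [eq_comm]

theorem IsEuler.mul {a b : ℂ} {p q : Poly} (hp : IsEuler a p) (hq : IsEuler b q) :
    IsEuler (a + b) (p * q) := by
  rw [IsEuler, Fin.sum_univ_three] at *
  simp only [MvPolynomial.pderiv_mul, C.map_add]
  linear_combination q * hp + p * hq

/-- Differentiating Euler's identity lowers the degree by one. Since degrees are complex numbers, no
truncated subtraction intervenes in low degree. -/
theorem IsEuler.pderiv {a : ℂ} {p : Poly} (hp : IsEuler a p) (j : Fin 3) :
    IsEuler (a - 1) (pderiv j p) := by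
  have h := congrArg (MvPolynomial.pderiv j : Poly → Poly) hp
  rw [Fin.sum_univ_three] at h
  rw [IsEuler, Fin.sum_univ_three, pderiv_comm 0 j, pderiv_comm 1 j, pderiv_comm 2 j]
  simp only [map_add, MvPolynomial.pderiv_mul, MvPolynomial.pderiv_C] at h ⊢
  have hC : (C (a - 1) : Poly) = C a - 1 := by rw [map_sub, map_one]
  have hd : ∑ i : Fin 3, MvPolynomial.pderiv j (X i : Poly) * MvPolynomial.pderiv i p =
      MvPolynomial.pderiv j p := by
    simp only [pderiv_X_eq, ite_mul, one_mul, zero_mul, Finset.sum_ite_eq, Finset.mem_univ,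
      if_true]
  rw [hC]
  rw [Fin.sum_univ_three] at hd
  linear_combination h - hd

theorem IsEuler.add {a : ℂ} {p q : Poly} (hp : IsEuler a p) (hq : IsEuler a q) :
    IsEuler a (p + q) := by
  rw [IsEuler, Fin.sum_univ_three] at *
  simp only [map_add]
  linear_combination hp + hq

theorem IsEuler.laplacian {a : ℂ} {p : Poly} (hp : IsEuler a p) :
    IsEuler (a - 2) (polyLaplacian p) := by
  have h : ∀ i : Fin 3, IsEuler (a - 2) (MvPolynomial.pderiv i (MvPolynomial.pderiv i p)) := by
    intro i
    have := (hp.pderiv i).pderiv i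
    rwa [sub_sub, one_add_one_eq_two] at this
  rw [polyLaplacian_apply, Fin.sum_univ_three]
  exact ((h 0).add (h 1)).add (h 2)

theorem sphereIntegral_C_mul (c : ℂ) (p : Poly) : sphereIntegral (C c * p) = c * sphereIntegral p := by
  rw [← MvPolynomial.smul_eq_C_mul, map_smul, smul_eq_mul]

theorem sphereIntegral_normSq_mul (p : Poly) :
    sphereIntegral (normSqPoly * p) = sphereIntegral p :=
  sphereIntegral_congr (restrict_normSq_mul p)

/-- This plays the role of the divergence theorem. Summing the rotations in the planes `(i, j)`
applied to `X j * p` gives `(a+2) x_i p - |x|² ∂_i p` by Euler's identity. The sum integrates to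
zero, and `|x|² = 1` on the sphere. -/
theorem sphereIntegral_pderiv {a : ℂ} {p : Poly} (hp : IsEuler a p) (i : Fin 3) :
    sphereIntegral (pderiv i p) = (a + 2) * sphereIntegral (X i * p) := by
  have h : ∑ j, rotDeriv i j (X j * p) = C (a + 2) * (X i * p) - normSqPoly * pderiv i p := by
    rw [IsEuler, Fin.sum_univ_three] at hp
    simp only [rotDeriv_apply, Fin.sum_univ_three, MvPolynomial.pderiv_mul, pderiv_X_eq,
      normSqPoly, C.map_add, map_ofNat]
    fin_cases i <;> simp <;> linear_combination (X _) * hp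
  have h2 := congrArg sphereIntegral h
  rw [map_sum, map_sub, sphereIntegral_C_mul, sphereIntegral_normSq_mul] at h2
  simp only [sphereIntegral_rotDeriv, Finset.sum_const_zero] at h2
  linear_combination h2

/-- Apply `sphereIntegral_pderiv` to `q ∂_i p`, of degree `a + b - 1`, and sum over `i`; Euler's
identity for `p` supplies the factor `b`. -/
theorem sphereIntegral_green {a b : ℂ} {p q : Poly} (hq : IsEuler a q) (hp : IsEuler b p) :
    sphereIntegral (∑ i, pderiv i q * pderiv i p) + sphereIntegral (q * polyLaplacian p) =
      (a + b + 1) * b * sphereIntegral (q * p) := by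
  have h1 : ∀ i, sphereIntegral (pderiv i q * pderiv i p) +
      sphereIntegral (q * pderiv i (pderiv i p)) =
      (a + b + 1) * sphereIntegral (q * (X i * pderiv i p)) := by
    intro i
    have h := sphereIntegral_pderiv (hq.mul (hp.pderiv i)) i
    rw [MvPolynomial.pderiv_mul, map_add] at h
    rw [h, show a + (b - 1) + 2 = a + b + 1 by ring]
    congr 2
    ring
  rw [polyLaplacian_apply, Finset.mul_sum, map_sum, map_sum, ← Finset.sum_add_distrib,
    Finset.sum_congr rfl fun i _ => h1 i, ← Finset.mul_sum, ← map_sum, ← Finset.mul_sum, hp,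
    show q * (C b * p) = C b * (q * p) by ring, sphereIntegral_C_mul]
  ring

/-- Green's formula for harmonic `p`, `q` has a left side symmetric in the two, so exchanging them
gives `(b - a)(a + b + 1) ∫ q p = 0`. -/
theorem sphereIntegral_mul_eq_zero {a b : ℂ} {p q : Poly} (hq : IsEuler a q) (hp : IsEuler b p)
    (hq0 : polyLaplacian q = 0) (hp0 : polyLaplacian p = 0) (hab : a ≠ b) (hab' : a + b + 1 ≠ 0) :
    sphereIntegral (q * p) = 0 := by
  have h1 := sphereIntegral_green hq hp
  have h2 := sphereIntegral_green hp hq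
  simp only [mul_comm (pderiv _ p)] at h2
  rw [hp0, mul_zero, map_zero, add_zero] at h1
  rw [hq0, mul_zero, map_zero, add_zero, mul_comm p q, h1] at h2
  have h3 : (b - a) * ((a + b + 1) * sphereIntegral (q * p)) = 0 := by linear_combination h2
  simpa [sub_eq_zero, hab.symm, hab'] using h3

theorem polyLaplacian_normSq_mul {a : ℂ} {q : Poly} (hq : IsEuler a q) :
    polyLaplacian (normSqPoly * q) = normSqPoly * polyLaplacian q + C (4 * a + 6) * q := by
  rw [IsEuler, Fin.sum_univ_three] at hq
  simp only [polyLaplacian_apply, Fin.sum_univ_three, normSqPoly, pow_two, MvPolynomial.pderiv_mul,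
    map_add, pderiv_X_eq, C.map_mul, map_ofNat]
  simp
  linear_combination 4 * hq

/-! ### Polynomials restrict to sums of spherical harmonics -/

/-- Each commutation of a Laplacian past `|x|²` contributes `4(a - 2i) + 6`, the degree having
dropped by `2i`. Summing over `i = 0, …, j` gives `(j+1)(4a + 6 - 4j)`. -/
theorem laplacian_iterate_normSq_mul {a : ℂ} {q : Poly} (hq : IsEuler a q) (j : ℕ) :
    IsEuler (a - 2 * j) (polyLaplacian^[j] q) ∧
    polyLaplacian^[j + 1] (normSqPoly * q) = normSqPoly * polyLaplacian^[j + 1] q +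
      C ((j + 1) * (4 * a + 6 - 4 * j)) * polyLaplacian^[j] q := by
  induction j with
  | zero =>
    refine ⟨by simpa only [Nat.cast_zero, mul_zero, sub_zero, Function.iterate_zero_apply] using hq, ?_⟩
    simp only [zero_add, Function.iterate_one, Function.iterate_zero_apply, Nat.cast_zero, one_mul,
      mul_zero, sub_zero]
    exact polyLaplacian_normSq_mul hq
  | succ j ih =>
    have h1 : IsEuler (a - 2 * (j + 1 : ℕ)) (polyLaplacian^[j + 1] q) := by
      have := ih.1.laplacian
      rw [← Function.iterate_succ_apply' (f := polyLaplacian)] at this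
      convert this using 1; push_cast; ring
    refine ⟨h1, ?_⟩
    rw [Function.iterate_succ_apply', ih.2, map_add, polyLaplacian_normSq_mul h1,
      ← Function.iterate_succ_apply' (f := polyLaplacian), ← MvPolynomial.smul_eq_C_mul _ (_ * _),
      map_smul, MvPolynomial.smul_eq_C_mul, ← Function.iterate_succ_apply' (f := polyLaplacian),
      add_assoc, ← add_mul, ← C.map_add]
    congr 3
    push_cast
    ring

theorem laplacian_isHomogeneous {p : Poly} {n : ℕ} (h : p.IsHomogeneous n) :
    (polyLaplacian p).IsHomogeneous (n - 2) := by
  rw [polyLaplacian_apply]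
  exact MvPolynomial.IsHomogeneous.sum _ _ _ fun i _ => h.pderiv.pderiv

theorem harmonics_le_V {l N : ℕ} (h : l ≤ N) : harmonics l ≤ V N :=
  le_iSup₂_of_le (f := fun l (_ : l ∈ Finset.range (N + 1)) => harmonics l) l
    (Finset.mem_range.2 (Nat.lt_succ_of_le h)) le_rfl

theorem restrict_mem_harmonics {p : Poly} {l : ℕ} (h : p.IsHomogeneous l)
    (h0 : polyLaplacian p = 0) : restrictToSphere p ∈ harmonics l :=
  ⟨p, ⟨h, h0⟩, rfl⟩

/-- Induction on the number of Laplacians needed to kill `p`. On the sphere `p` equals `(p -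
c⁻¹|x|²Δp) + c⁻¹Δp`, and for the right `c` both summands are killed by one Laplacian fewer. -/
theorem restrict_mem_V_of_laplacian_iterate (N j : ℕ) : ∀ (d : ℕ) (p : Poly), d ≤ N →
    p.IsHomogeneous d → polyLaplacian^[j] p = 0 → restrictToSphere p ∈ V N := by
  induction j with
  | zero =>
    intro d p _ _ h0
    rw [Function.iterate_zero_apply] at h0
    rw [h0, map_zero]
    exact Submodule.zero_mem _
  | succ j ih =>
    intro d p hd hp h0
    rcases Nat.lt_or_ge d 2 with hd2 | hd2
    · refine harmonics_le_V hd (restrict_mem_harmonics hp ?_)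
      rw [polyLaplacian_apply]
      refine Finset.sum_eq_zero fun i _ => ?_
      have h1 : (pderiv i p).IsHomogeneous 0 := by
        have := hp.pderiv (i := i)
        rwa [show d - 1 = 0 by omega] at this
      rw [← MvPolynomial.totalDegree_zero_iff_isHomogeneous,
        MvPolynomial.totalDegree_eq_zero_iff_eq_C] at h1
      rw [h1, MvPolynomial.pderiv_C]
    obtain ⟨e, rfl⟩ : ∃ e, d = e + 2 := ⟨d - 2, by omega⟩
    have hq : (polyLaplacian p).IsHomogeneous e := laplacian_isHomogeneous hp
    rcases j with _ | j
    · exact harmonics_le_V hd (restrict_mem_harmonics hp h0)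
    have hmem := ih e _ (by omega) hq (by rwa [Function.iterate_succ_apply] at h0)
    obtain ⟨-, hlap⟩ := laplacian_iterate_normSq_mul (isEuler_of_isHomogeneous hq) j
    have h0' : polyLaplacian^[j + 1] (polyLaplacian p) = 0 := h0
    rw [h0', mul_zero, zero_add] at hlap
    set c : ℂ := (j + 1) * (4 * e + 6 - 4 * j) with hc
    have hc0 : c ≠ 0 := by
      refine mul_ne_zero (by exact_mod_cast Nat.succ_ne_zero j) ?_
      -- The integer `4e + 6 - 4j` is congruent to `2` modulo `4`, so it is nonzero whatever `e` and
      -- `j` are.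
      intro h
      have : ((4 * e + 6 - 4 * j : ℤ) : ℂ) = ((0 : ℤ) : ℂ) := by push_cast; exact h
      have := Int.cast_injective this
      omega
    have hp' : restrictToSphere (p - c⁻¹ • (normSqPoly * polyLaplacian p)) ∈ V N := by
      refine ih (e + 2) _ hd ?_ ?_
      · have hr : (normSqPoly * polyLaplacian p).IsHomogeneous (e + 2) := by
          rw [add_comm]
          exact (MvPolynomial.IsHomogeneous.sum _ _ _ fun i _ =>
            MvPolynomial.isHomogeneous_X_pow i 2).mul hq
        exact (MvPolynomial.homogeneousSubmodule (Fin 3) ℂ (e + 2)).sub_mem hp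
          (Submodule.smul_mem _ _ hr)
      · rw [← Module.End.pow_apply, map_sub, map_smul, Module.End.pow_apply, Module.End.pow_apply,
          hlap, ← MvPolynomial.smul_eq_C_mul, smul_smul, inv_mul_cancel₀ hc0, one_smul,
          ← Function.iterate_succ_apply, sub_self]
    have : restrictToSphere p = restrictToSphere (p - c⁻¹ • (normSqPoly * polyLaplacian p)) +
        c⁻¹ • restrictToSphere (polyLaplacian p) := by
      rw [map_sub, map_smul, restrict_normSq_mul]
      abel
    rw [this]
    exact Submodule.add_mem _ hp' (Submodule.smul_mem _ _ hmem)

theorem laplacian_iterate_isHomogeneous {p : Poly} {n : ℕ} (h : p.IsHomogeneous n) (j : ℕ) :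
    (polyLaplacian^[j] p).IsHomogeneous (n - 2 * j) := by
  induction j with
  | zero => exact h
  | succ j ih =>
    rw [Function.iterate_succ_apply']
    exact laplacian_isHomogeneous ih

theorem restrict_mem_V {N : ℕ} {p : Poly} (hp : p.totalDegree ≤ N) :
    restrictToSphere p ∈ V N := by
  rw [← MvPolynomial.sum_homogeneousComponent p, map_sum]
  refine Submodule.sum_mem _ fun d hd => ?_
  have hh := MvPolynomial.homogeneousComponent_isHomogeneous d p
  -- After `d` Laplacians the truncated degree `d - 2d` is `0`, so what is left is constant; one
  -- more kills it.
  refine restrict_mem_V_of_laplacian_iterate N (d + 1) d _ (by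
    have := Finset.mem_range.1 hd; omega) hh ?_
  have h1 := laplacian_iterate_isHomogeneous hh d
  rw [show d - 2 * d = 0 by omega, ← MvPolynomial.totalDegree_zero_iff_isHomogeneous,
    MvPolynomial.totalDegree_eq_zero_iff_eq_C] at h1
  rw [Function.iterate_succ_apply', h1, polyLaplacian_apply]
  simp

theorem exists_poly_of_mem_harmonics {l : ℕ} {f : S2 → ℂ} (hf : f ∈ harmonics l) :
    ∃ p : Poly, p.IsHomogeneous l ∧ polyLaplacian p = 0 ∧ restrictToSphere p = f := by
  obtain ⟨p, ⟨h1, h2⟩, h3⟩ := hf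
  exact ⟨p, h1, h2, h3⟩

theorem exists_poly_of_mem_V {N : ℕ} {f : S2 → ℂ} (hf : f ∈ V N) :
    ∃ p : Poly, p.totalDegree ≤ N ∧ restrictToSphere p = f := by
  have h : V N ≤ (MvPolynomial.restrictTotalDegree (Fin 3) ℂ N).map restrictToSphere := by
    refine iSup₂_le fun l hl f hf => ?_
    obtain ⟨p, h1, -, h3⟩ := exists_poly_of_mem_harmonics hf
    refine ⟨p, ?_, h3⟩
    rw [SetLike.mem_coe, MvPolynomial.mem_restrictTotalDegree]
    exact h1.totalDegree_le.trans (Nat.lt_succ_iff.1 (Finset.mem_range.1 hl))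
  obtain ⟨p, h1, h2⟩ := h hf
  exact ⟨p, (MvPolynomial.mem_restrictTotalDegree _ _ _).1 h1, h2⟩

theorem restrict_mul (p q : Poly) :
    restrictToSphere (p * q) = fun x => restrictToSphere p x * restrictToSphere q x := by
  ext x
  simp [restrictToSphere_apply]

theorem mul_mem_V {N : ℕ} {f g : S2 → ℂ} (hf : f ∈ V N) (hg : g ∈ V N) :
    (fun x => f x * g x) ∈ V (2 * N) := by
  obtain ⟨p, hp, rfl⟩ := exists_poly_of_mem_V hf
  obtain ⟨q, hq, rfl⟩ := exists_poly_of_mem_V hg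
  rw [← restrict_mul]
  exact restrict_mem_V ((MvPolynomial.totalDegree_mul p q).trans (by omega))

theorem continuous_of_mem_V {N : ℕ} {f : S2 → ℂ} (hf : f ∈ V N) : Continuous f := by
  obtain ⟨p, -, rfl⟩ := exists_poly_of_mem_V hf
  exact continuous_restrict p

theorem continuous_of_mem_harmonics {l : ℕ} {f : S2 → ℂ} (hf : f ∈ harmonics l) : Continuous f :=
  continuous_of_mem_V (harmonics_le_V le_rfl hf)

/-! ### Orthogonality of the spherical harmonics of different degrees -/

/-- The pairing is bilinear, without conjugation; the Hermitian version follows because `harmonics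
l'` is stable under conjugation. -/
theorem integral_mul_harmonics {l l' : ℕ} (h : l ≠ l') {f g : S2 → ℂ} (hf : f ∈ harmonics l)
    (hg : g ∈ harmonics l') : ∫ x, f x * g x ∂σ = 0 := by
  obtain ⟨p, hp, hp0, rfl⟩ := exists_poly_of_mem_harmonics hf
  obtain ⟨q, hq, hq0, rfl⟩ := exists_poly_of_mem_harmonics hg
  rw [← restrict_mul]
  refine sphereIntegral_mul_eq_zero (isEuler_of_isHomogeneous hp) (isEuler_of_isHomogeneous hq)
    hp0 hq0 (by exact_mod_cast h) ?_
  exact_mod_cast Nat.succ_ne_zero (l + l')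

/-- Complex conjugation of the coefficients. -/
def conjPoly : Poly →+* Poly := MvPolynomial.map (starRingEnd ℂ)

theorem restrict_conjPoly (p : Poly) (x : S2) :
    restrictToSphere (conjPoly p) x = conj (restrictToSphere p x) := by
  simp only [restrictToSphere_apply, conjPoly]
  induction p using MvPolynomial.induction_on with
  | C a => simp
  | add p q hp hq => simp only [map_add, hp, hq]
  | mul_X p i hp => simp [hp]

theorem conj_mem_harmonics {l : ℕ} {f : S2 → ℂ} (hf : f ∈ harmonics l) :
    (fun x => conj (f x)) ∈ harmonics l := by
  obtain ⟨p, hp, hp0, rfl⟩ := exists_poly_of_mem_harmonics hf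
  have h : (fun x => conj (restrictToSphere p x)) = restrictToSphere (conjPoly p) :=
    funext fun x => (restrict_conjPoly p x).symm
  rw [h]
  refine restrict_mem_harmonics (hp.map _) ?_
  simp only [polyLaplacian_apply, conjPoly, MvPolynomial.pderiv_map] at hp0 ⊢
  rw [← map_sum, hp0, map_zero]

/-! ### The dimension of the space of spherical harmonics -/

theorem laplacian_coeff {p : Poly} (h : polyLaplacian p = 0) (m : Fin 3 →₀ ℕ) :
    ∑ i, p.coeff (m + Finsupp.single i 1 + Finsupp.single i 1) *
      (((m + Finsupp.single i 1 : Fin 3 →₀ ℕ) i : ℕ) + 1) * ((m i : ℕ) + 1) = 0 := by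
  have h1 := congrArg (MvPolynomial.coeff m) h
  rw [polyLaplacian_apply, MvPolynomial.coeff_sum, MvPolynomial.coeff_zero] at h1
  simpa only [MvPolynomial.coeff_pderiv] using h1

/-- The exponent `(a, b, c)`. -/
def exponent (a b c : ℕ) : Fin 3 →₀ ℕ := 
  Finsupp.single 0 a + Finsupp.single 1 b + Finsupp.single 2 c

/-- Cauchy data in the variable `z`: the equation `Δp = 0` expresses a coefficient with `z`-exponent
`c + 2` through those with `z`-exponent `c`. So the exponents `0` and `1`, which carry `(l + 1) + l`
coefficients, determine `p`. -/
theorem eq_zero_of_coeff_eq_zero {p : Poly} {l : ℕ} (hp : p.IsHomogeneous l)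
    (h : polyLaplacian p = 0) (h0 : ∀ a ≤ l, p.coeff (exponent a (l - a) 0) = 0)
    (h1 : ∀ a < l, p.coeff (exponent a (l - 1 - a) 1) = 0) : p = 0 := by
  have key : ∀ (c : ℕ) (m : Fin 3 →₀ ℕ), m 2 = c → p.coeff m = 0 := by
    intro c
    induction c using Nat.strong_induction_on with
    | _ c ih =>
      intro m hm
      by_contra hne
      have hdeg := hp hne
      rw [Finsupp.weight_apply, Finsupp.sum_fintype _ _ (by simp)] at hdeg
      simp only [Fin.sum_univ_three, Pi.one_apply, smul_eq_mul, mul_one] at hdeg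
      rcases c with _ | _ | c
      · refine hne ?_
        rw [show m = exponent (m 0) (l - m 0) 0 by
          ext i; fin_cases i <;> simp [exponent] <;> omega]
        exact h0 _ (by omega)
      · refine hne ?_
        rw [show m = exponent (m 0) (l - 1 - m 0) 1 by
          ext i; fin_cases i <;> simp [exponent] <;> omega]
        exact h1 _ (by omega)
      · have hm' : m = exponent (m 0) (m 1) c + Finsupp.single 2 1 + Finsupp.single 2 1 := by
          ext i; fin_cases i <;> simp [exponent] <;> omega
        have hl := laplacian_coeff h (exponent (m 0) (m 1) c)
        rw [Fin.sum_univ_three, ← hm',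
          ih c (by omega) (exponent (m 0) (m 1) c + Finsupp.single 0 1 + Finsupp.single 0 1)
            (by simp [exponent]),
          ih c (by omega) (exponent (m 0) (m 1) c + Finsupp.single 1 1 + Finsupp.single 1 1)
            (by simp [exponent])] at hl
        rw [zero_mul, zero_mul, zero_mul, zero_mul, zero_add, zero_add, mul_assoc] at hl
        refine (mul_ne_zero hne ?_) hl
        exact mul_ne_zero (Nat.cast_add_one_ne_zero _) (Nat.cast_add_one_ne_zero _)
  ext m
  exact key _ m rfl

/-- The coefficients of a polynomial at the monomials of degree `l` whose degree in the last
variable is at most one. -/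
def coeffMap (l : ℕ) : Poly →ₗ[ℂ] (Fin (l + 1) ⊕ Fin l → ℂ) :=
  LinearMap.pi fun s => MvPolynomial.lcoeff ℂ (Sum.elim
    (fun a : Fin (l + 1) => exponent a (l - a) 0) (fun a : Fin l => exponent a (l - 1 - a) 1) s)

theorem finite_finrank_harmonics (l : ℕ) :
    Module.Finite ℂ (harmonics l) ∧ Module.finrank ℂ (harmonics l) ≤ 2 * l + 1 := by
  set H := MvPolynomial.homogeneousSubmodule (Fin 3) ℂ l ⊓ LinearMap.ker polyLaplacian with hH
  have hinj : Function.Injective ((coeffMap l).comp H.subtype) := by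
    rw [← LinearMap.ker_eq_bot, LinearMap.ker_eq_bot']
    rintro ⟨p, hp, hp0⟩ h
    refine Subtype.ext (eq_zero_of_coeff_eq_zero hp hp0 (fun a ha => ?_) (fun a ha => ?_))
    · exact congrFun h (Sum.inl ⟨a, Nat.lt_succ_of_le ha⟩)
    · exact congrFun h (Sum.inr ⟨a, ha⟩)
  have hfin : Module.Finite ℂ H := Module.Finite.of_injective _ hinj
  have hrank := LinearMap.finrank_le_finrank_of_injective hinj
  rw [Module.finrank_fintype_fun_eq_card, Fintype.card_sum, Fintype.card_fin,
    Fintype.card_fin] at hrank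
  refine ⟨Module.Finite.map H restrictToSphere, (Submodule.finrank_map_le _ H).trans ?_⟩
  omega

/-- The `2l + 1` functions are independent by orthonormality, so the upper bound `2l + 1` on the
dimension suffices. -/
theorem span_eq_harmonics {l : ℕ} {y : ℤ → S2 → ℂ}
    (hy : ∀ m ∈ Set.Icc (-(l : ℤ)) l, y m ∈ harmonics l)
    (ho : ∀ m ∈ Set.Icc (-(l : ℤ)) l, ∀ m' ∈ Set.Icc (-(l : ℤ)) l,
      ∫ x, y m x * conj (y m' x) ∂σ = if m = m' then 1 else 0) :
    Submodule.span ℂ (y '' Set.Icc (-(l : ℤ)) l) = harmonics l := by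
  obtain ⟨hfin, hrank⟩ := finite_finrank_harmonics l
  have hli : LinearIndependent ℂ fun m : Finset.Icc (-(l : ℤ)) l => y m := by
    rw [Fintype.linearIndependent_iff]
    intro c hc m'
    have hcont : ∀ m : Finset.Icc (-(l : ℤ)) l, Continuous (y m) := fun m =>
      continuous_of_mem_harmonics (hy m (Finset.mem_Icc.1 m.2))
    have h : ∫ x, (∑ m, c m • y m) x * conj (y m' x) ∂σ = c m' := by
      simp only [Finset.sum_apply, Pi.smul_apply, smul_eq_mul, Finset.sum_mul, mul_assoc]
      have hint : ∀ m : Finset.Icc (-(l : ℤ)) l,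
          Integrable (fun x => c m * (y m x * conj (y m' x))) σ := fun m =>
        integrable_of_continuous (continuous_const.mul
          ((hcont m).mul (Complex.continuous_conj.comp (hcont m'))))
      rw [integral_finsetSum _ fun m _ => hint m]
      simp only [integral_const_mul]
      rw [Finset.sum_congr rfl fun m _ => by
        rw [ho m (Finset.mem_Icc.1 m.2) m' (Finset.mem_Icc.1 m'.2)]]
      simp
    rw [← h, hc]
    simp
  refine Submodule.eq_of_le_of_finrank_le ?_ ?_
  · rw [Submodule.span_le]
    rintro - ⟨m, hm, rfl⟩
    exact hy m hm
  · have hset : y '' Set.Icc (-(l : ℤ)) l =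
        Set.range fun m : Finset.Icc (-(l : ℤ)) l => y m := by
      ext f
      simp [Set.mem_range]
    rw [hset, finrank_span_eq_card hli, Fintype.card_coe, Int.card_Icc]
    refine hrank.trans ?_
    omega

/-! ### Legendre polynomials -/

section Legendre
open Polynomial

/-- With `y = (x² - 1)^l` one has `(x² - 1) y' = 2 l x y`; differentiate this `n + 1` times. -/
theorem derivative_sq_sub_one_pow (l n : ℕ) :
    ((Polynomial.X : ℝ[X]) ^ 2 - 1) * derivative^[n + 2] ((Polynomial.X ^ 2 - 1) ^ l) +
      (2 * ((n : ℝ[X]) + 1) - 2 * (l : ℝ[X])) * Polynomial.X *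
        derivative^[n + 1] ((Polynomial.X ^ 2 - 1) ^ l) +
      ((n : ℝ[X]) + 1) * ((n : ℝ[X]) - 2 * (l : ℝ[X])) * derivative^[n] ((Polynomial.X ^ 2 - 1) ^ l) = 0 := by
  set y : ℝ[X] := (Polynomial.X ^ 2 - 1) ^ l with hy
  have hq : derivative ((Polynomial.X : ℝ[X]) ^ 2 - 1) = 2 * Polynomial.X := by
    rw [derivative_sub, derivative_X_pow, derivative_one]
    simp [← map_ofNat (Polynomial.C : ℝ →+* ℝ[X]) 2]
  have h0 : ((Polynomial.X : ℝ[X]) ^ 2 - 1) * derivative y = 2 * (l : ℝ[X]) * Polynomial.X * y := by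
    rw [hy, derivative_pow, hq]
    rcases l with _ | l
    · simp
    · simp only [Nat.add_sub_cancel, map_natCast]
      ring
  have hd : ∀ k, derivative (derivative^[k] y) = derivative^[k + 1] y := fun k =>
    (Function.iterate_succ_apply' _ _ _).symm
  induction n with
  | zero =>
    have h1 := congrArg derivative h0
    simp only [derivative_mul, hq, derivative_X, derivative_natCast, derivative_ofNat] at h1
    simp only [Function.iterate_succ_apply', Function.iterate_zero_apply, zero_add, Nat.cast_zero]
    linear_combination h1
  | succ n ih =>
    have h1 := congrArg derivative ih
    simp only [derivative_mul, derivative_add, derivative_sub, hq, derivative_X,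
      derivative_natCast, derivative_ofNat, derivative_one, derivative_zero, hd] at h1
    push_cast
    linear_combination h1

/-- The derivatives of the Legendre polynomial. -/
def legendreD (l k : ℕ) : ℝ[X] := derivative^[k] (legendre l)

theorem derivative_legendreD (l k : ℕ) : derivative (legendreD l k) = legendreD l (k + 1) :=
  (Function.iterate_succ_apply' _ _ _).symm

theorem legendreD_eq (l k : ℕ) : legendreD l k = Polynomial.C (1 / (2 ^ l * (l.factorial : ℝ))) *
    derivative^[l + k] ((Polynomial.X ^ 2 - 1) ^ l) := by
  rw [legendreD, legendre, iterate_derivative_C_mul, ← Function.iterate_add_apply, add_comm k]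

theorem legendreD_ode (l k : ℕ) :
    (1 - Polynomial.X ^ 2) * legendreD l (k + 2) -
        2 * ((k : ℝ[X]) + 1) * Polynomial.X * legendreD l (k + 1) =
      -(((l : ℝ[X]) - (k : ℝ[X])) * ((l : ℝ[X]) + (k : ℝ[X]) + 1)) * legendreD l k := by
  have h := derivative_sq_sub_one_pow l (l + k)
  simp only [legendreD_eq, ← add_assoc] at h ⊢
  push_cast at h
  linear_combination -Polynomial.C (1 / (2 ^ l * (l.factorial : ℝ))) * h

/-- Only the leading term of the monic polynomial `(x² - 1)^l` survives `2l` derivatives. -/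
theorem legendreD_self (l : ℕ) : legendreD l l =
    Polynomial.C (((2 * l).factorial : ℝ) / (2 ^ l * (l.factorial : ℝ))) := by
  have hmon : ((Polynomial.X : ℝ[X]) ^ 2 - 1).Monic := by monicity!
  have hdeg : (((Polynomial.X : ℝ[X]) ^ 2 - 1) ^ l).natDegree = 2 * l := by
    have h2 : ((Polynomial.X : ℝ[X]) ^ 2 - 1).natDegree = 2 := by
      rw [← Polynomial.C_1, natDegree_X_pow_sub_C]
    rw [hmon.natDegree_pow, h2, mul_comm]
  have h : derivative^[2 * l] (((Polynomial.X : ℝ[X]) ^ 2 - 1) ^ l) =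
      Polynomial.C ((2 * l).factorial : ℝ) := by
    have h1 := natDegree_iterate_derivative (((Polynomial.X : ℝ[X]) ^ 2 - 1) ^ l) (2 * l)
    rw [hdeg, Nat.sub_self] at h1
    rw [eq_C_of_natDegree_le_zero h1, coeff_iterate_derivative, zero_add, Nat.descFactorial_self,
      ← hdeg, Polynomial.coeff_natDegree, (hmon.pow l).leadingCoeff]
    simp
  rw [legendreD_eq, ← two_mul, h, ← Polynomial.C_mul]
  congr 1
  ring

end Legendre

/-! ### Ladder operators and the standard spherical harmonics -/

theorem rotationFun_zero (i j : Fin 3) (y : R3) : rotationFun i j 0 y = y := by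
  unfold rotationFun
  ext k
  by_cases h1 : k = i
  · subst h1; simp
  · by_cases h2 : k = j
    · subst h2; simp [h1]
    · simp [h1, h2]

/-- Infinitesimal rotations are tangent to the sphere, so their effect there depends only on the
restriction. This allows a polynomial to be replaced by a harmonic representative before a ladder
operator is applied. -/
theorem restrict_rotDeriv_eq_zero {i j : Fin 3} {p : Poly} (h : restrictToSphere p = 0) :
    restrictToSphere (rotDeriv i j p) = 0 := by
  by_cases hij : i = j
  · subst hij
    rw [rotDeriv_apply, sub_self, map_zero]
  ext x
  have h1 := hasDerivAt_evalAt_rotation hij p x 0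
  have h2 : (fun s => evalAt (rotationFun i j s x) p) = fun _ => 0 := by
    funext s
    rw [← restrict_sphereMap_rotation hij, h]
    rfl
  rw [h2, rotationFun_zero] at h1
  rw [restrictToSphere_apply]
  exact h1.unique (hasDerivAt_const _ _)

/-- The polynomial `x + iy`. -/
def zeta : Poly := X 0 + C Complex.I * X 1

/-- The polynomial `x - iy`. -/
def zetaBar : Poly := X 0 - C Complex.I * X 1

theorem C_I_mul_C_I : (C Complex.I * C Complex.I : Poly) = -1 := by
  rw [← C.map_mul, Complex.I_mul_I, map_neg, map_one]

theorem zeta_mul_zetaBar_add : zeta * zetaBar + X 2 ^ 2 = normSqPoly := by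
  simp only [zeta, zetaBar, normSqPoly, Fin.sum_univ_three]
  linear_combination (-(X 1) ^ 2 : Poly) * C_I_mul_C_I

/-- The lowering operator. -/
def lowering : Derivation ℂ Poly Poly := rotDeriv 0 2 - Complex.I • rotDeriv 1 2

/-- The raising operator. -/
def raising : Derivation ℂ Poly Poly := rotDeriv 0 2 + Complex.I • rotDeriv 1 2

theorem lowering_apply (p : Poly) :
    lowering p = rotDeriv 0 2 p - C Complex.I * rotDeriv 1 2 p := by
  rw [← MvPolynomial.smul_eq_C_mul]; rfl

theorem raising_apply (p : Poly) :
    raising p = rotDeriv 0 2 p + C Complex.I * rotDeriv 1 2 p := by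
  rw [← MvPolynomial.smul_eq_C_mul]; rfl

theorem restrict_lowering_congr {p q : Poly} (h : restrictToSphere p = restrictToSphere q) :
    restrictToSphere (lowering p) = restrictToSphere (lowering q) := by
  have h0 : restrictToSphere (p - q) = 0 := by rw [map_sub, h, sub_self]
  rw [← sub_eq_zero, ← map_sub, ← map_sub, lowering_apply, map_sub, ← MvPolynomial.smul_eq_C_mul,
    map_smul, restrict_rotDeriv_eq_zero h0, restrict_rotDeriv_eq_zero h0, smul_zero, sub_zero]

theorem sphereIntegral_raising (p : Poly) : sphereIntegral (raising p) = 0 := by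
  rw [raising_apply, map_add, sphereIntegral_C_mul, sphereIntegral_rotDeriv,
    sphereIntegral_rotDeriv, mul_zero, add_zero]

theorem rotDeriv_zeta_table :
    lowering zeta = -2 * X 2 ∧ lowering (X 2) = zetaBar ∧
    raising zetaBar = -2 * X 2 ∧ raising (X 2) = zeta ∧ raising zeta = 0 ∧
    rotDeriv 0 1 zeta = C Complex.I * zeta ∧ rotDeriv 0 1 zetaBar = -C Complex.I * zetaBar ∧
    rotDeriv 0 1 (X 2) = 0 := by
  refine ⟨?_, ?_, ?_, ?_, ?_, ?_, ?_, ?_⟩ <;>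
    simp only [lowering_apply, raising_apply, rotDeriv_apply, zeta, zetaBar, map_add, map_sub,
      MvPolynomial.pderiv_C_mul, pderiv_X_eq] <;> simp <;>
    first
    | ring1
    | linear_combination (X 2 : Poly) * C_I_mul_C_I
    | linear_combination -(X 2 : Poly) * C_I_mul_C_I
    | linear_combination (X 1 : Poly) * C_I_mul_C_I
    | linear_combination -(X 1 : Poly) * C_I_mul_C_I

/-- A real polynomial, evaluated at the variable `z`. -/
def zPoly (u : Polynomial ℝ) : Poly :=
  Polynomial.aeval (X 2 : Poly) (u.map (algebraMap ℝ ℂ))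

theorem derivation_zPoly (D : Derivation ℂ Poly Poly) (u : Polynomial ℝ) :
    D (zPoly u) = zPoly u.derivative * D (X 2) := by
  rw [zPoly, D.map_aeval, zPoly, Polynomial.derivative_map, smul_eq_mul]

theorem zPoly_mul (u v : Polynomial ℝ) : zPoly (u * v) = zPoly u * zPoly v := by
  simp [zPoly]

theorem zPoly_C (c : ℝ) : zPoly (Polynomial.C c) = C (c : ℂ) := by
  simp [zPoly, MvPolynomial.algebraMap_eq]

theorem restrict_zPoly (u : Polynomial ℝ) (x : S2) :
    restrictToSphere (zPoly u) x = ((u.eval ((x : R3) 2) : ℝ) : ℂ) := by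
  rw [restrictToSphere_apply, zPoly, ← Polynomial.aeval_algHom_apply, evalAt_X,
    Polynomial.aeval_map_algebraMap, ← Complex.coe_algebraMap, Polynomial.aeval_algebraMap_apply]
  simp

theorem restrict_mul_congr {p p' q q' : Poly} (h : restrictToSphere p = restrictToSphere p')
    (h' : restrictToSphere q = restrictToSphere q') :
    restrictToSphere (p * q) = restrictToSphere (p' * q') := by
  rw [restrict_mul, restrict_mul, h, h']

/-- The ladder relation, for the lowering operator on `zeta` and for the raising operator on
`zetaBar`. -/
theorem restrict_ladder (D : Derivation ℂ Poly Poly) {a b : Poly} (ha : D a = -2 * X 2)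
    (hb : D (X 2) = b) (hab : a * b + X 2 ^ 2 = normSqPoly) (l k : ℕ) :
    restrictToSphere (D (a ^ (k + 1) * zPoly (legendreD l (k + 1)))) =
      restrictToSphere (C (-(((l : ℂ) - k) * (l + k + 1))) * (a ^ k * zPoly (legendreD l k))) := by
  have hode := congrArg zPoly (legendreD_ode l k)
  have hz : zPoly ((1 - Polynomial.X ^ 2) * legendreD l (k + 2) -
      2 * ((k : Polynomial ℝ) + 1) * Polynomial.X * legendreD l (k + 1)) =
      (1 - X 2 ^ 2) * zPoly (legendreD l (k + 2)) -
      2 * ((k : Poly) + 1) * X 2 * zPoly (legendreD l (k + 1)) := by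
    simp only [zPoly, Polynomial.map_sub, Polynomial.map_mul, Polynomial.map_add,
      Polynomial.map_one, Polynomial.map_pow, Polynomial.map_X, Polynomial.map_natCast,
      Polynomial.map_ofNat, map_sub, map_mul, map_add, map_one, map_pow, Polynomial.aeval_X,
      map_natCast, map_ofNat]
  have hz' : zPoly (-(((l : Polynomial ℝ) - (k : Polynomial ℝ)) *
      ((l : Polynomial ℝ) + (k : Polynomial ℝ) + 1)) * legendreD l k) =
      C (-(((l : ℂ) - k) * (l + k + 1))) * zPoly (legendreD l k) := by
    simp [zPoly]
  rw [hz, hz'] at hode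
  -- The Legendre equation contains `1 - z²` where the product rule gives `a b = |x|² - z²`. The
  -- discrepancy is a multiple of `|x|² - 1` and disappears on the sphere.
  have h1 : D (a ^ (k + 1) * zPoly (legendreD l (k + 1))) =
      C (-(((l : ℂ) - k) * (l + k + 1))) * (a ^ k * zPoly (legendreD l k)) +
      (normSqPoly * (a ^ k * zPoly (legendreD l (k + 2))) -
        a ^ k * zPoly (legendreD l (k + 2))) := by
    rw [D.leibniz, derivation_zPoly, derivative_legendreD, hb, D.leibniz_pow, ha]
    simp only [smul_eq_mul, nsmul_eq_mul, Nat.add_sub_cancel]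
    push_cast
    linear_combination a ^ k * hode + a ^ k * zPoly (legendreD l (k + 2)) * hab
  rw [h1, map_add, map_sub, restrict_normSq_mul, sub_self, add_zero]

theorem pderiv_eq_zero_of_isHomogeneous_zero {p : Poly} (hp : p.IsHomogeneous 0) (i : Fin 3) :
    pderiv i p = 0 := by
  rw [← MvPolynomial.totalDegree_zero_iff_isHomogeneous,
    MvPolynomial.totalDegree_eq_zero_iff_eq_C] at hp
  rw [hp, MvPolynomial.pderiv_C]

theorem rotDeriv_isHomogeneous {p : Poly} {l : ℕ} (hp : p.IsHomogeneous l) (i j : Fin 3) :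
    (rotDeriv i j p).IsHomogeneous l := by
  have h : ∀ i j : Fin 3, (X i * pderiv j p).IsHomogeneous l := by
    intro i j
    rcases l with _ | l
    · rw [pderiv_eq_zero_of_isHomogeneous_zero hp, mul_zero]
      exact MvPolynomial.isHomogeneous_zero _ _ _
    · rw [add_comm]
      exact (MvPolynomial.isHomogeneous_X ℂ i).mul hp.pderiv
  exact (h i j).sub (h j i)

theorem polyLaplacian_rotDeriv (i j : Fin 3) (p : Poly) :
    polyLaplacian (rotDeriv i j p) = rotDeriv i j (polyLaplacian p) := by
  have h : ∀ i j : Fin 3, polyLaplacian (X i * pderiv j p) =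
      X i * pderiv j (polyLaplacian p) + 2 * pderiv i (pderiv j p) := by
    intro i j
    simp only [polyLaplacian_apply, MvPolynomial.pderiv_mul, map_add, map_sum, pderiv_X_eq]
    have h1 : ∀ k : Fin 3, pderiv k (pderiv k (pderiv j p)) = pderiv j (pderiv k (pderiv k p)) :=
      fun k => by rw [pderiv_comm k j p, pderiv_comm k j]
    simp only [h1, Fin.sum_univ_three]
    fin_cases i <;> simp <;> ring
  rw [rotDeriv_apply, map_sub, h, h, rotDeriv_apply, pderiv_comm i j p]
  ring

theorem lowering_harmonic {p : Poly} {l : ℕ} (hp : p.IsHomogeneous l) (h0 : polyLaplacian p = 0) :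
    (lowering p).IsHomogeneous l ∧ polyLaplacian (lowering p) = 0 := by
  have hI := MvPolynomial.smul_eq_C_mul (rotDeriv 1 2 p) Complex.I
  rw [lowering_apply, ← hI]
  refine ⟨(rotDeriv_isHomogeneous hp 0 2).sub
    ((MvPolynomial.homogeneousSubmodule (Fin 3) ℂ l).smul_mem _ (rotDeriv_isHomogeneous hp 1 2)), ?_⟩
  rw [map_sub, map_smul, polyLaplacian_rotDeriv, polyLaplacian_rotDeriv, h0, map_zero, map_zero,
    smul_zero, sub_zero]

theorem zeta_pow_harmonic (l : ℕ) :
    (zeta ^ l).IsHomogeneous l ∧ polyLaplacian (zeta ^ l) = 0 := by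
  constructor
  · have h1 := (MvPolynomial.isHomogeneous_C (Fin 3) Complex.I).mul
      (MvPolynomial.isHomogeneous_X ℂ (1 : Fin 3))
    rw [zero_add] at h1
    have h : zeta.IsHomogeneous 1 := (MvPolynomial.isHomogeneous_X ℂ 0).add h1
    simpa using h.pow l
  · have h0 : pderiv 0 zeta = 1 := by
      simp [zeta]
    have h1 : pderiv 1 zeta = C Complex.I := by
      simp [zeta]
    have h2 : pderiv 2 zeta = 0 := by
      simp [zeta]
    rw [polyLaplacian_apply, Fin.sum_univ_three]
    simp only [MvPolynomial.pderiv_pow, MvPolynomial.pderiv_mul, h0, h1, h2, MvPolynomial.pderiv_C,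
      mul_zero, map_zero, add_zero, mul_one, Derivation.map_natCast,
      zero_mul, zero_add]
    linear_combination ((l : Poly) * ((l - 1 : ℕ) : Poly) * zeta ^ (l - 1 - 1)) * C_I_mul_C_I

/-- Descent from the highest weight `ζ^l`, which is visibly harmonic. Lowering preserves harmonicity
and degree, and the ladder constant `-(l-k)(l+k+1)` is nonzero for `k < l`. -/
theorem restrict_core_mem_harmonics (l j : ℕ) : ∀ k, k + j = l →
    restrictToSphere (zeta ^ k * zPoly (legendreD l k)) ∈ harmonics l := by
  induction j with
  | zero =>
    rintro k rfl
    rw [add_zero, legendreD_self, zPoly_C, mul_comm, ← MvPolynomial.smul_eq_C_mul, map_smul]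
    exact Submodule.smul_mem _ _
      (restrict_mem_harmonics (zeta_pow_harmonic k).1 (zeta_pow_harmonic k).2)
  | succ j ih =>
    intro k hk
    obtain ⟨p, hp, hp0, hpr⟩ := exists_poly_of_mem_harmonics (ih (k + 1) (by omega))
    have h := restrict_ladder lowering rotDeriv_zeta_table.1 rotDeriv_zeta_table.2.1
      zeta_mul_zetaBar_add l k
    rw [← restrict_lowering_congr hpr, ← MvPolynomial.smul_eq_C_mul, map_smul] at h
    have hc : -(((l : ℂ) - k) * (l + k + 1)) ≠ 0 := by
      rw [← hk]
      push_cast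
      rw [show (k : ℂ) + (j + 1) - k = ((j + 1 : ℕ) : ℂ) by push_cast; ring,
        show (k : ℂ) + (j + 1) + k + 1 = ((k + (j + 1) + k + 1 : ℕ) : ℂ) by push_cast; ring]
      exact neg_ne_zero.2 (mul_ne_zero (Nat.cast_ne_zero.2 (by omega))
        (Nat.cast_ne_zero.2 (by omega)))
    rw [← inv_smul_eq_iff₀ hc] at h
    rw [← h]
    exact Submodule.smul_mem _ _ (restrict_mem_harmonics (lowering_harmonic hp hp0).1
      (lowering_harmonic hp hp0).2)

/-- The monomial is an eigenvector of the rotation about the `z`-axis with eigenvalue `i(a - b) ≠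
0`, and the image of that rotation integrates to zero. -/
theorem sphereIntegral_weight {a b : ℕ} (hab : a ≠ b) (u : Polynomial ℝ) :
    sphereIntegral (zeta ^ a * zetaBar ^ b * zPoly u) = 0 := by
  obtain ⟨-, -, -, -, -, h1, h2, h3⟩ := rotDeriv_zeta_table
  have hpow : ∀ (p c : Poly) (n : ℕ), rotDeriv 0 1 p = c * p →
      rotDeriv 0 1 (p ^ n) = (n : Poly) * c * p ^ n := by
    intro p c n h
    rw [Derivation.leibniz_pow, h]
    rcases n with _ | n
    · simp
    · simp only [Nat.add_sub_cancel, smul_eq_mul, nsmul_eq_mul]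
      ring
  have h : rotDeriv 0 1 (zeta ^ a * zetaBar ^ b * zPoly u) =
      C (((a : ℂ) - b) * Complex.I) * (zeta ^ a * zetaBar ^ b * zPoly u) := by
    rw [Derivation.leibniz, Derivation.leibniz, derivation_zPoly, h3, hpow _ _ _ h1,
      hpow _ _ _ h2]
    simp only [smul_eq_mul, map_mul, map_sub, map_natCast]
    ring
  have h4 := sphereIntegral_rotDeriv 0 1 (zeta ^ a * zetaBar ^ b * zPoly u)
  rw [h, sphereIntegral_C_mul] at h4
  refine (mul_eq_zero.1 h4).resolve_left (mul_ne_zero ?_ Complex.I_ne_zero)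
  rw [sub_ne_zero]
  exact_mod_cast hab

theorem sphereIntegral_zeta_pow_mul (l : ℕ) :
    sphereIntegral (zeta ^ l * zetaBar ^ l) * (2 * l + 1).factorial =
      4 * Real.pi * (2 ^ l * l.factorial) ^ 2 := by
  obtain ⟨-, -, h1, h2, h3, -⟩ := rotDeriv_zeta_table
  induction l with
  | zero => simp [sphereIntegral_one]
  | succ l ih =>
    -- Integrating this gives the recursion `(2l+3) I_{l+1} = (2l+2) I_l` for `I_l = ∫ |ζ|^{2l}`.
    have h : raising (zeta ^ l * (zetaBar ^ (l + 1) * X 2)) =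
        C (2 * (l : ℂ) + 3) * (zeta ^ (l + 1) * zetaBar ^ (l + 1)) -
        C (2 * (l : ℂ) + 2) * (normSqPoly * (zeta ^ l * zetaBar ^ l)) := by
      rw [Derivation.leibniz, Derivation.leibniz, Derivation.leibniz_pow, Derivation.leibniz_pow,
        h1, h2, h3, ← zeta_mul_zetaBar_add]
      simp only [smul_eq_mul, nsmul_eq_mul, map_add, map_mul, map_natCast, map_ofNat,
        Nat.add_sub_cancel]
      push_cast
      ring
    have h4 := sphereIntegral_raising (zeta ^ l * (zetaBar ^ (l + 1) * X 2))
    rw [h, map_sub, sphereIntegral_C_mul, sphereIntegral_C_mul, sphereIntegral_normSq_mul] at h4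
    rw [show 2 * (l + 1) + 1 = 2 * l + 1 + 1 + 1 by ring, Nat.factorial_succ (2 * l + 1 + 1),
      Nat.factorial_succ (2 * l + 1), Nat.factorial_succ l]
    push_cast
    linear_combination (2 * (l : ℂ) + 2) * ((2 * l + 1).factorial : ℂ) * h4 +
      (2 * (l : ℂ) + 2) ^ 2 * ih

/-- Raising is a derivation with zero integral, hence skew. Moving it from one factor to the other
gives `N_{k+1} = (l-k)(l+k+1) N_k` for the squared norms `N_k`. Descent starts at `k = l`, where the
Legendre factor is constant. -/
theorem sphereIntegral_core_sq (l j : ℕ) : ∀ k, k + j = l →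
    sphereIntegral (zeta ^ k * zetaBar ^ k * zPoly (legendreD l k * legendreD l k)) *
      ((2 * l + 1) * j.factorial) = 4 * Real.pi * (l + k).factorial := by
  obtain ⟨-, -, h1, h2, h3, -⟩ := rotDeriv_zeta_table
  induction j with
  | zero =>
    rintro k rfl
    have hA := sphereIntegral_zeta_pow_mul k
    rw [add_zero, legendreD_self, ← Polynomial.C_mul, zPoly_C, mul_comm _ (C _),
      sphereIntegral_C_mul, ← two_mul]
    rw [Nat.factorial_succ] at hA
    push_cast at hA ⊢
    have hk : ((k.factorial : ℕ) : ℂ) ≠ 0 := Nat.cast_ne_zero.2 (Nat.factorial_ne_zero k)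
    field_simp
    rw [Nat.factorial_zero, Nat.cast_one]
    linear_combination ((2 * k).factorial : ℂ) * hA
  | succ j ih =>
    intro k hk
    have hr := restrict_ladder raising h1 h2 (by rw [mul_comm]; exact zeta_mul_zetaBar_add) l k
    set e : Poly := zeta ^ k * zPoly (legendreD l k) with he
    set b : Poly := zetaBar ^ (k + 1) * zPoly (legendreD l (k + 1)) with hb
    have hR : raising e = zeta ^ (k + 1) * zPoly (legendreD l (k + 1)) := by
      rw [he, Derivation.leibniz, Derivation.leibniz_pow, h3, derivation_zPoly, h2,
        derivative_legendreD]
      simp only [smul_eq_mul, nsmul_eq_mul]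
      ring
    have h0 := sphereIntegral_raising (e * b)
    rw [Derivation.leibniz, smul_eq_mul, smul_eq_mul, map_add,
      sphereIntegral_congr (restrict_mul_congr rfl hr), hR] at h0
    have h4 := ih (k + 1) (by omega)
    rw [show e * (C (-(((l : ℂ) - k) * (l + k + 1))) * (zetaBar ^ k * zPoly (legendreD l k))) =
      C (-(((l : ℂ) - k) * (l + k + 1))) *
        (zeta ^ k * zetaBar ^ k * zPoly (legendreD l k * legendreD l k)) by
        rw [he, zPoly_mul]; ring, sphereIntegral_C_mul,
      show b * (zeta ^ (k + 1) * zPoly (legendreD l (k + 1))) = zeta ^ (k + 1) *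
        zetaBar ^ (k + 1) * zPoly (legendreD l (k + 1) * legendreD l (k + 1)) by
        rw [hb, zPoly_mul]; ring] at h0
    rw [← add_assoc, Nat.factorial_succ] at h4
    have hlk : (l : ℂ) - k = j + 1 := by rw [← hk]; push_cast; ring
    have hne : (l : ℂ) + k + 1 ≠ 0 := by exact_mod_cast Nat.succ_ne_zero (l + k)
    refine mul_left_cancel₀ hne ?_
    rw [Nat.factorial_succ]
    rw [hlk] at h0
    push_cast at h4 ⊢
    linear_combination h4 - (2 * (l : ℂ) + 1) * (j.factorial : ℂ) * h0

theorem restrict_monomial (a b : ℕ) (u : Polynomial ℝ) (x : S2) :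
    restrictToSphere (zeta ^ a * zetaBar ^ b * zPoly u) x =
      (((x : R3) 0 : ℂ) + Complex.I * ((x : R3) 1 : ℂ)) ^ a *
      (((x : R3) 0 : ℂ) - Complex.I * ((x : R3) 1 : ℂ)) ^ b * ((u.eval ((x : R3) 2) : ℝ) : ℂ) := by
  rw [restrict_mul, ← restrict_zPoly]
  simp only [restrictToSphere_apply, zeta, zetaBar, map_mul, map_pow, map_add, map_sub, evalAt_X,
    evalAt_C]

theorem conj_restrict_monomial (a b : ℕ) (u : Polynomial ℝ) (x : S2) :
    conj (restrictToSphere (zeta ^ a * zetaBar ^ b * zPoly u) x) =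
      restrictToSphere (zeta ^ b * zetaBar ^ a * zPoly u) x := by
  rw [restrict_monomial, restrict_monomial]
  simp only [map_mul, map_pow, map_add, map_sub, Complex.conj_ofReal, Complex.conj_I]
  ring

/-- The normalization constant of the standard spherical harmonics. -/
def harmonicConst (l k : ℕ) : ℝ :=
  √((2 * l + 1) / (4 * Real.pi) * ((l - k).factorial / (l + k).factorial : ℝ))

/-- One of `m.toNat` and `(-m).toNat` is zero, so a single monomial covers both signs of `m`. The
sign of `s` does not matter: only `s²` enters the norm. -/
theorem exists_standardY_eq (l : ℕ) (m : ℤ) : ∃ s : ℝ, s ^ 2 = harmonicConst l m.natAbs ^ 2 ∧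
    standardY l m = (s : ℂ) • restrictToSphere
      (zeta ^ m.toNat * zetaBar ^ (-m).toNat * zPoly (legendreD l m.natAbs)) := by
  rcases le_or_gt 0 m with hm | hm
  · refine ⟨(-1) ^ m.natAbs * harmonicConst l m.natAbs, ?_, ?_⟩
    · rw [mul_pow, ← pow_mul, mul_comm _ 2, pow_mul]
      simp
    · ext x
      rw [standardY, if_pos hm, Pi.smul_apply, restrict_monomial, smul_eq_mul, harmonicCore,
        show m.toNat = m.natAbs by omega, show (-m).toNat = 0 by omega]
      simp only [legendreD, harmonicConst]
      push_cast
      ring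
  · refine ⟨harmonicConst l m.natAbs, rfl, ?_⟩
    ext x
    rw [standardY, if_neg hm.not_ge, Pi.smul_apply, restrict_monomial, smul_eq_mul, harmonicCore,
      show m.toNat = 0 by omega, show (-m).toNat = m.natAbs by omega]
    simp only [map_mul, map_pow, map_add, Complex.conj_ofReal, Complex.conj_I, legendreD,
      harmonicConst]
    ring

theorem standardY_mem_harmonics {l : ℕ} {m : ℤ} (hm : m ∈ Set.Icc (-(l : ℤ)) l) :
    standardY l m ∈ harmonics l := by
  obtain ⟨s, -, h⟩ := exists_standardY_eq l m
  obtain ⟨h1, h2⟩ := hm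
  have hk : m.natAbs + (l - m.natAbs) = l := by omega
  have hcore := restrict_core_mem_harmonics l _ _ hk
  rw [h]
  refine Submodule.smul_mem _ _ ?_
  rcases le_or_gt 0 m with hm | hm
  · rw [show m.toNat = m.natAbs by omega, show (-m).toNat = 0 by omega, pow_zero, mul_one]
    exact hcore
  · rw [show m.toNat = 0 by omega, show (-m).toNat = m.natAbs by omega]
    have := conj_mem_harmonics hcore
    convert this using 1
    ext x
    rw [show zeta ^ m.natAbs * zPoly (legendreD l m.natAbs) =
      zeta ^ m.natAbs * zetaBar ^ 0 * zPoly (legendreD l m.natAbs) by ring,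
      conj_restrict_monomial]

/-- The scalar factor of `standardY l m`. -/
def standardConst (l : ℕ) (m : ℤ) : ℝ := (exists_standardY_eq l m).choose

theorem standardConst_sq (l : ℕ) (m : ℤ) :
    standardConst l m ^ 2 = harmonicConst l m.natAbs ^ 2 :=
  (exists_standardY_eq l m).choose_spec.1

theorem standardY_eq (l : ℕ) (m : ℤ) : standardY l m = (standardConst l m : ℂ) • restrictToSphere
    (zeta ^ m.toNat * zetaBar ^ (-m).toNat * zPoly (legendreD l m.natAbs)) :=
  (exists_standardY_eq l m).choose_spec.2

theorem integral_standardY_mul_conj {l : ℕ} {m m' : ℤ} (hm : m ∈ Set.Icc (-(l : ℤ)) l) :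
    ∫ x, standardY l m x * conj (standardY l m' x) ∂σ = if m = m' then 1 else 0 := by
  have hint : ∫ x, standardY l m x * conj (standardY l m' x) ∂σ =
      ((standardConst l m * standardConst l m' : ℝ) : ℂ) *
      sphereIntegral (zeta ^ (m.toNat + (-m').toNat) * zetaBar ^ ((-m).toNat + m'.toNat) *
        zPoly (legendreD l m.natAbs * legendreD l m'.natAbs)) := by
    rw [sphereIntegral_apply, ← integral_const_mul]
    congr 1
    ext x
    rw [standardY_eq, standardY_eq, Pi.smul_apply, Pi.smul_apply, smul_eq_mul, smul_eq_mul,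
      map_mul (starRingEnd ℂ), conj_restrict_monomial, Complex.conj_ofReal, restrict_monomial,
      restrict_monomial, restrict_monomial, Polynomial.eval_mul]
    push_cast
    ring
  rw [hint]
  split_ifs with hmm
  · subst hmm
    obtain ⟨h1, h2⟩ := hm
    have hk : m.natAbs + (l - m.natAbs) = l := by omega
    have hN := sphereIntegral_core_sq l _ _ hk
    rw [← pow_two, standardConst_sq, harmonicConst, Real.sq_sqrt (by positivity),
      show m.toNat + (-m).toNat = m.natAbs by omega, show (-m).toNat + m.toNat = m.natAbs by omega]
    have h3 : (((l - m.natAbs).factorial : ℕ) : ℂ) ≠ 0 :=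
      Nat.cast_ne_zero.2 (Nat.factorial_ne_zero _)
    have h4 : (((l + m.natAbs).factorial : ℕ) : ℂ) ≠ 0 :=
      Nat.cast_ne_zero.2 (Nat.factorial_ne_zero _)
    have h5 : (Real.pi : ℂ) ≠ 0 := Complex.ofReal_ne_zero.2 Real.pi_ne_zero
    push_cast
    field_simp
    linear_combination hN
  -- The exponents of `zeta` and `zetaBar` differ by `m - m'`.
  · rw [sphereIntegral_weight (by omega), mul_zero]

theorem isOrthonormalHarmonicBasis_standardY (L : ℕ) : IsOrthonormalHarmonicBasis L standardY where
  span_eq l _ := span_eq_harmonics (fun _ hm => standardY_mem_harmonics hm)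
    (fun _ hm _ _ => integral_standardY_mul_conj hm)
  orthonormal l _ m hm l' _ m' hm' := by
    by_cases hl : l = l'
    · subst hl
      rw [integral_standardY_mul_conj hm]
      simp
    · rw [integral_mul_harmonics hl (standardY_mem_harmonics hm)
        (conj_mem_harmonics (standardY_mem_harmonics hm')), if_neg (fun h => hl h.1)]

/-! ### The Laplacian of a function on the sphere and its `C²` norm -/

theorem contDiff_evalAt (p : Poly) (n : WithTop ℕ∞) : ContDiff ℝ n fun y : R3 => evalAt y p := by
  induction p using MvPolynomial.induction_on with
  | C a => simpa using contDiff_const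
  | add p q hp hq =>
    simp only [map_add]
    exact hp.add hq
  | mul_X p i hp =>
    simp only [map_mul, evalAt_X]
    exact hp.mul (Complex.ofRealCLM.contDiff.comp
      (EuclideanSpace.proj i : R3 →L[ℝ] ℝ).contDiff)

theorem radialExt_coe (f : S2 → ℝ) {P : Poly} (hP : ∀ x, (f x : ℂ) = restrictToSphere P x)
    {y : R3} (hy : y ≠ 0) : radialExt f y = (evalAt (‖y‖⁻¹ • y) P).re := by
  rw [radialExt, dif_pos hy, ← Complex.ofReal_re (f _), hP, restrictToSphere_apply]

theorem radialExt_of_mem (f : S2 → ℝ) {y : R3} (hy : ‖y‖ = 1) :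
    radialExt f y = f ⟨y, by simpa using hy⟩ := by
  have h0 : y ≠ 0 := by
    rintro rfl
    simp at hy
  rw [radialExt, dif_pos h0]
  simp [hy]

theorem contDiffAt_radialExt {f : S2 → ℝ} {P : Poly}
    (hP : ∀ x, (f x : ℂ) = restrictToSphere P x) {y : R3} (hy : y ≠ 0) (n : WithTop ℕ∞) :
    ContDiffAt ℝ n (radialExt f) y := by
  have h : ContDiffAt ℝ n (fun z : R3 => (evalAt (‖z‖⁻¹ • z) P).re) y := by
    have h1 : ContDiffAt ℝ n (fun z : R3 => ‖z‖⁻¹ • z) y :=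
      ((contDiffAt_norm ℝ hy).inv (norm_ne_zero_iff.2 hy)).smul contDiffAt_id
    exact Complex.reCLM.contDiff.contDiffAt.comp y
      ((contDiff_evalAt P n).contDiffAt.comp y h1)
  refine h.congr_of_eventuallyEq ?_
  filter_upwards [isOpen_ne.mem_nhds hy] with z hz
  exact radialExt_coe f hP hz

/-- The extension is constant on rays. This removes the acceleration term `γ'' = -γ` from second
derivatives along great circles. -/
theorem fderiv_radialExt_self {f : S2 → ℝ} {P : Poly}
    (hP : ∀ x, (f x : ℂ) = restrictToSphere P x) {y : R3} (hy : y ≠ 0) :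
    fderiv ℝ (radialExt f) y y = 0 := by
  have h1 : HasDerivAt (fun s : ℝ => s • y) y 1 := by
    simpa using (hasDerivAt_id (1 : ℝ)).smul_const y
  have h2 : HasFDerivAt (radialExt f) (fderiv ℝ (radialExt f) y) ((1 : ℝ) • y) := by
    rw [one_smul]
    exact ((contDiffAt_radialExt hP hy 1).differentiableAt one_ne_zero).hasFDerivAt
  have h3 := h2.comp_hasDerivAt (1 : ℝ) h1
  have h4 : (radialExt f ∘ fun s : ℝ => s • y) =ᶠ[nhds 1] fun _ => radialExt f y := by
    filter_upwards [isOpen_Ioi.mem_nhds (show (1 : ℝ) ∈ Set.Ioi 0 by simp)] with s hs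
    have hs0 : (0 : ℝ) < s := hs
    rw [Function.comp_apply, radialExt_coe f hP (smul_ne_zero hs0.ne' hy), radialExt_coe f hP hy,
      norm_smul, Real.norm_of_nonneg hs0.le, smul_smul, mul_inv, mul_right_comm,
      inv_mul_cancel₀ hs0.ne', one_mul]
  exact h3.unique ((hasDerivAt_const _ _).congr_of_eventuallyEq h4)

/-- The second derivative at `x` of a polynomial along the great circle through `x` in the
direction `v`. -/
def greatCircleDeriv (x v : R3) : Poly →ₗ[ℂ] ℂ :=
  (∑ i, ∑ j, ((v i : ℂ) * (v j : ℂ)) • (evalAt x).toLinearMap ∘ₗ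
    ((pderiv j).toLinearMap ∘ₗ (pderiv i).toLinearMap)) -
  ∑ i, (x i : ℂ) • (evalAt x).toLinearMap ∘ₗ (pderiv i).toLinearMap

theorem greatCircleDeriv_apply (x v : R3) (p : Poly) : greatCircleDeriv x v p =
    (∑ i, ∑ j, (v i : ℂ) * (v j : ℂ) * evalAt x (pderiv j (pderiv i p))) -
      ∑ i, (x i : ℂ) * evalAt x (pderiv i p) := by
  simp [greatCircleDeriv]

/-- The great circle through `x` in the direction `v`. -/
def greatCircle (x v : R3) (t : ℝ) : R3 := Real.cos t • x + Real.sin t • v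

theorem hasDerivAt_greatCircle (x v : R3) (t : ℝ) :
    HasDerivAt (greatCircle x v) (greatCircle v (-x) t) t := by
  have h := ((Real.hasDerivAt_cos t).smul_const x).add ((Real.hasDerivAt_sin t).smul_const v)
  refine h.congr_deriv ?_
  simp only [greatCircle]
  module

theorem greatCircle_zero (x v : R3) : greatCircle x v 0 = x := by
  simp [greatCircle]

theorem norm_greatCircle {x v : R3} (hx : ‖x‖ = 1) (hv : ‖v‖ = 1) (hxv : inner ℝ x v = 0)
    (t : ℝ) : ‖greatCircle x v t‖ = 1 := by
  have h : ‖greatCircle x v t‖ ^ 2 = 1 := by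
    rw [greatCircle, norm_add_sq_real, norm_smul, norm_smul, inner_smul_left, inner_smul_right,
      hxv, hx, hv]
    simp
  exact (sq_eq_sq₀ (norm_nonneg _) zero_le_one).1 (by rw [h, one_pow])

theorem hasDerivAt_greatCircle_apply (x v : R3) (t : ℝ) (i : Fin 3) :
    HasDerivAt (fun s => greatCircle x v s i) (greatCircle v (-x) t i) t :=
  (EuclideanSpace.proj i : R3 →L[ℝ] ℝ).hasFDerivAt.comp_hasDerivAt t (hasDerivAt_greatCircle x v t)

theorem hasDerivAt_evalAt_greatCircle (x v : R3) (p : Poly) (t : ℝ) :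
    HasDerivAt (fun s => evalAt (greatCircle x v s) p)
      (∑ i, (greatCircle v (-x) t i : ℂ) * evalAt (greatCircle x v t) (pderiv i p)) t :=
  hasDerivAt_evalAt (γ' := fun i => greatCircle v (-x) t i)
    (hasDerivAt_greatCircle_apply x v t) p

theorem hasDerivAt_deriv_evalAt_greatCircle (x v : R3) (p : Poly) :
    HasDerivAt (fun t => ∑ i, (greatCircle v (-x) t i : ℂ) *
      evalAt (greatCircle x v t) (pderiv i p)) (greatCircleDeriv x v p) 0 := by
  have h : ∀ i, HasDerivAt (fun t => (greatCircle v (-x) t i : ℂ) *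
      evalAt (greatCircle x v t) (pderiv i p))
      (((-x : R3) i : ℂ) * evalAt x (pderiv i p) +
        (v i : ℂ) * ∑ j, (v j : ℂ) * evalAt x (pderiv j (pderiv i p))) 0 := by
    intro i
    have h1 : HasDerivAt (fun t => (greatCircle v (-x) t i : ℂ)) ((-x : R3) i : ℂ) 0 := by
      have := hasDerivAt_greatCircle_apply v (-x) 0 i
      rw [greatCircle_zero] at this
      exact this.ofReal_comp
    have h2 := hasDerivAt_evalAt_greatCircle x v (pderiv i p) 0
    have h3 := h1.mul h2
    simp only [greatCircle_zero] at h3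
    exact h3
  refine (HasDerivAt.fun_sum fun i _ => h i).congr_deriv ?_
  rw [greatCircleDeriv_apply, Finset.sum_add_distrib, add_comm, sub_eq_add_neg,
    ← Finset.sum_neg_distrib]
  congr 1
  · refine Finset.sum_congr rfl fun i _ => ?_
    rw [Finset.mul_sum]
    exact Finset.sum_congr rfl fun j _ => by ring
  · exact Finset.sum_congr rfl fun i _ => by simp

/-- Both sides are the second derivative at `0` of `f` along the great circle, computed through the
radial extension and through `P`. The acceleration `-x` contributes nothing to the first and gives
`-∑ x_i ∂_i P` in the second. -/
theorem fderiv_fderiv_radialExt {f : S2 → ℝ} {P : Poly}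
    (hP : ∀ x, (f x : ℂ) = restrictToSphere P x) {x v : R3} (hx : ‖x‖ = 1) (hv : ‖v‖ = 1)
    (hxv : inner ℝ x v = 0) :
    ((fderiv ℝ (fderiv ℝ (radialExt f)) x v v : ℝ) : ℂ) = greatCircleDeriv x v P := by
  have hne : ∀ t, greatCircle x v t ≠ 0 := fun t h => by
    have := norm_greatCircle hx hv hxv t
    rw [h, norm_zero] at this
    exact zero_ne_one this
  have h1 : ∀ t, HasDerivAt (fun s => radialExt f (greatCircle x v s))
      (fderiv ℝ (radialExt f) (greatCircle x v t) (greatCircle v (-x) t)) t := fun t =>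
    ((contDiffAt_radialExt hP (hne t) 1).differentiableAt
      one_ne_zero).hasFDerivAt.comp_hasDerivAt t (hasDerivAt_greatCircle x v t)
  have h2 : HasDerivAt
      (fun t => fderiv ℝ (radialExt f) (greatCircle x v t) (greatCircle v (-x) t))
      (fderiv ℝ (fderiv ℝ (radialExt f)) x v v) 0 := by
    have hd : DifferentiableAt ℝ (fderiv ℝ (radialExt f)) (greatCircle x v 0) :=
      ((contDiffAt_radialExt hP (hne 0) 2).fderiv_right (m := 1) le_rfl).differentiableAt
        one_ne_zero
    have h3 := (hd.hasFDerivAt.comp_hasDerivAt (0 : ℝ) (hasDerivAt_greatCircle x v 0)).clm_apply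
      (hasDerivAt_greatCircle v (-x) 0)
    simp only [Function.comp_def, greatCircle_zero] at h3
    have hx0 : x ≠ 0 := by simpa [greatCircle_zero] using hne 0
    rw [map_neg, fderiv_radialExt_self hP hx0, neg_zero, add_zero] at h3
    exact h3
  have h4 : ∀ t, ((radialExt f (greatCircle x v t) : ℝ) : ℂ) = evalAt (greatCircle x v t) P := by
    intro t
    rw [radialExt_of_mem f (norm_greatCircle hx hv hxv t), hP, restrictToSphere_apply]
  have h5 : ∀ t, ((fderiv ℝ (radialExt f) (greatCircle x v t) (greatCircle v (-x) t) : ℝ) : ℂ) =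
      ∑ i, (greatCircle v (-x) t i : ℂ) * evalAt (greatCircle x v t) (pderiv i P) := fun t => by
    have h6 := (h1 t).ofReal_comp
    simp only [h4] at h6
    exact h6.unique (hasDerivAt_evalAt_greatCircle x v P t)
  have h7 := h2.ofReal_comp
  simp only [h5] at h7
  exact h7.unique (hasDerivAt_deriv_evalAt_greatCircle x v P)

theorem tangentProj_of_inner_eq_zero {x : S2} {v : R3} (h : inner ℝ (x : R3) v = 0) :
    tangentProj x v = v :=
  Submodule.starProjection_eq_self_iff.2 (Submodule.mem_orthogonal_singleton_iff_inner_right.2 h)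

theorem norm_tangentProj_le (x : S2) : ‖tangentProj x‖ ≤ 1 :=
  Submodule.starProjection_norm_le _

/-- A real supremum bounds its family only when the family is bounded; here compactness of the
sphere provides the bound. -/
theorem bddAbove_norm_sphHessian {f : S2 → ℝ} {P : Poly}
    (hP : ∀ x, (f x : ℂ) = restrictToSphere P x) :
    BddAbove (Set.range fun x => ‖sphHessian f x‖) := by
  have hcont : Continuous fun x : S2 => ‖fderiv ℝ (fderiv ℝ (radialExt f)) (x : R3)‖ := by
    refine continuous_iff_continuousAt.2 fun x => ?_
    have hx : (x : R3) ≠ 0 := ne_zero_of_mem_unit_sphere x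
    have h : ContDiffAt ℝ 0 (fderiv ℝ (fderiv ℝ (radialExt f))) (x : R3) :=
      ((contDiffAt_radialExt hP hx 2).fderiv_right (m := 1) le_rfl).fderiv_right
        (m := 0) (by simp)
    exact (continuous_norm (E := R3 →L[ℝ] R3 →L[ℝ] ℝ)).continuousAt.comp (ContinuousAt.comp (f := fun x : S2 => (x : R3))
      h.continuousAt continuous_subtype_val.continuousAt)
  obtain ⟨B, hB⟩ := (isCompact_range hcont).bddAbove
  refine ⟨B, ?_⟩
  rintro - ⟨x, rfl⟩
  refine le_trans ?_ (hB ⟨x, rfl⟩)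
  refine ContinuousLinearMap.opNorm_le_bound₂ _
    (norm_nonneg (fderiv ℝ (fderiv ℝ (radialExt f)) (x : R3))) fun u v => ?_
  rw [sphHessian, ContinuousLinearMap.bilinearComp_apply]
  have hle : ∀ u, ‖tangentProj x u‖ ≤ ‖u‖ := fun u =>
    ((tangentProj x).le_of_opNorm_le (norm_tangentProj_le x) u).trans (one_mul _).le
  refine (ContinuousLinearMap.le_opNorm₂ _ _ _).trans ?_
  gcongr
  · exact hle u
  · exact hle v

theorem norm_greatCircleDeriv_le {f : S2 → ℝ} {P : Poly}
    (hP : ∀ x, (f x : ℂ) = restrictToSphere P x) (x : S2) {v : R3} (hv : ‖v‖ = 1)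
    (hxv : inner ℝ (x : R3) v = 0) : ‖greatCircleDeriv x v P‖ ≤ C2norm f := by
  have hx : ‖(x : R3)‖ = 1 := by simp
  rw [← fderiv_fderiv_radialExt hP hx hv hxv, Complex.norm_real]
  have h : fderiv ℝ (fderiv ℝ (radialExt f)) x v v = sphHessian f x v v := by
    rw [sphHessian, ContinuousLinearMap.bilinearComp_apply, tangentProj_of_inner_eq_zero hxv]
  rw [h]
  refine ((sphHessian f x).le_opNorm₂ v v).trans ?_
  rw [hv, mul_one, mul_one]
  exact (le_ciSup (bddAbove_norm_sphHessian hP) x).trans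
    ((le_max_right _ _).trans (le_max_right _ _))

/-- This is the eigenvalue equation. The trace of `D²p` in the frame `b` is `Δp = 0`, so the two
tangential second derivatives sum to `-D²p(b 0, b 0) = -l(l-1) p`. The two acceleration terms
subtract `2 l p`. -/
theorem sum_greatCircleDeriv {p : Poly} {l : ℕ} (hp : p.IsHomogeneous l)
    (hp0 : polyLaplacian p = 0) (b : OrthonormalBasis (Fin 3) ℝ R3) :
    greatCircleDeriv (b 0) (b 1) p + greatCircleDeriv (b 0) (b 2) p =
      -(l * (l + 1)) * evalAt (b 0) p := by
  have hE := isEuler_of_isHomogeneous hp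
  have h1 : ∑ i, (b 0 i : ℂ) * evalAt (b 0) (pderiv i p) = l * evalAt (b 0) p := by
    have := congrArg (evalAt (b 0)) hE
    simpa using this
  have h2 : ∀ i, ∑ j, (b 0 j : ℂ) * evalAt (b 0) (pderiv j (pderiv i p)) =
      (l - 1) * evalAt (b 0) (pderiv i p) := by
    intro i
    have := congrArg (evalAt (b 0)) (hE.pderiv i)
    simpa using this
  have h3 : ∑ i, evalAt (b 0) (pderiv i (pderiv i p)) = 0 := by
    rw [← map_sum, ← polyLaplacian_apply, hp0, map_zero]
  have hδ : ∀ i j : Fin 3, (b 0 i : ℂ) * b 0 j + (b 1 i : ℂ) * b 1 j + (b 2 i : ℂ) * b 2 j =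
      if i = j then 1 else 0 := by
    intro i j
    have := b.sum_inner_mul_inner (EuclideanSpace.single i (1 : ℝ)) (EuclideanSpace.single j 1)
    rw [Fin.sum_univ_three] at this
    simp only [EuclideanSpace.inner_single_left, EuclideanSpace.inner_single_right] at this
    have h := congrArg (fun r : ℝ => (r : ℂ)) this
    simp only [map_one, one_mul, conj_trivial] at h
    push_cast at h
    rw [h]
    simp only [PiLp.single_apply, eq_comm (a := j)]
    split_ifs <;> simp
  have h4 : ∑ i, ∑ j, ((b 0 i : ℂ) * b 0 j + (b 1 i : ℂ) * b 1 j + (b 2 i : ℂ) * b 2 j) *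
      evalAt (b 0) (pderiv j (pderiv i p)) = 0 := by
    simp only [hδ, ite_mul, one_mul, zero_mul, Finset.sum_ite_eq, Finset.mem_univ, if_true, h3]
  have h5 : ∑ i, ∑ j, (b 0 i : ℂ) * b 0 j * evalAt (b 0) (pderiv j (pderiv i p)) =
      (l - 1) * (l * evalAt (b 0) p) := by
    rw [← h1, Finset.mul_sum]
    refine Finset.sum_congr rfl fun i _ => ?_
    simp only [mul_assoc]
    rw [← Finset.mul_sum, h2]
    ring
  simp only [add_mul, Finset.sum_add_distrib] at h4
  rw [greatCircleDeriv_apply, greatCircleDeriv_apply, h1]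
  linear_combination h4 - h5

/-- The sum is `-Δf`, that is, minus the trace of the Hessian over two orthonormal tangent vectors,
each of which contributes at most `C2norm f`. -/
theorem norm_sum_eigenvalue_le {f : S2 → ℝ} {L : ℕ} {p : ℕ → Poly}
    (hp : ∀ l, (p l).IsHomogeneous l) (hp0 : ∀ l, polyLaplacian (p l) = 0)
    (hf : ∀ x, (f x : ℂ) = ∑ l ∈ Finset.range (L + 1), restrictToSphere (p l) x) (x : S2) :
    ‖∑ l ∈ Finset.range (L + 1), ((l : ℂ) * (l + 1)) * restrictToSphere (p l) x‖ ≤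
      2 * C2norm f := by
  have hP : ∀ x, (f x : ℂ) = restrictToSphere (∑ l ∈ Finset.range (L + 1), p l) x := by
    intro x
    rw [hf, map_sum, Finset.sum_apply]
  obtain ⟨b, hb⟩ := Orthonormal.exists_orthonormalBasis_extension_of_card_eq
    (𝕜 := ℝ) (E := R3) (ι := Fin 3) (by simp) (v := fun _ => (x : R3)) (s := {0}) (by
      rw [orthonormal_iff_ite]
      rintro ⟨i, rfl⟩ ⟨j, rfl⟩
      simp)
  have hb0 : b 0 = x := hb 0 rfl
  have hb1 := norm_greatCircleDeriv_le hP x (b.orthonormal.1 1)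
    (by rw [← hb0]; exact b.orthonormal.2 (by decide))
  have hb2 := norm_greatCircleDeriv_le hP x (b.orthonormal.1 2)
    (by rw [← hb0]; exact b.orthonormal.2 (by decide))
  have h : ∑ l ∈ Finset.range (L + 1), ((l : ℂ) * (l + 1)) * restrictToSphere (p l) x =
      -(greatCircleDeriv x (b 1) (∑ l ∈ Finset.range (L + 1), p l) +
        greatCircleDeriv x (b 2) (∑ l ∈ Finset.range (L + 1), p l)) := by
    rw [map_sum, map_sum, ← Finset.sum_add_distrib, ← Finset.sum_neg_distrib]
    refine Finset.sum_congr rfl fun l _ => ?_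
    have := sum_greatCircleDeriv (hp l) (hp0 l) b
    rw [hb0] at this
    rw [this, restrictToSphere_apply]
    ring
  rw [h, norm_neg]
  exact (norm_add_le _ _).trans (by linarith)

/-! ### Finite orthonormal expansions -/

theorem integral_sum_mul_conj {ι : Type*} {s : Finset ι} {e : ι → S2 → ℂ}
    (he : ∀ i ∈ s, Continuous (e i)) (c : ι → ℂ) {g : S2 → ℂ} (hg : Continuous g) :
    ∫ x, (∑ i ∈ s, c i * e i x) * conj (g x) ∂σ =
      ∑ i ∈ s, c i * ∫ x, e i x * conj (g x) ∂σ := by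
  have hint : ∀ i ∈ s, Integrable (fun x => c i * (e i x * conj (g x))) σ := fun i hi =>
    integrable_of_continuous (continuous_const.mul
      ((he i hi).mul (Complex.continuous_conj.comp hg)))
  simp only [Finset.sum_mul, mul_assoc]
  rw [integral_finsetSum _ hint]
  simp only [integral_const_mul]

theorem continuous_sum_mul {ι : Type*} {s : Finset ι} {e : ι → S2 → ℂ}
    (he : ∀ i ∈ s, Continuous (e i)) (c : ι → ℂ) :
    Continuous fun x => ∑ i ∈ s, c i * e i x :=
  continuous_finsetSum _ fun i hi => continuous_const.mul (he i hi)

theorem integral_expansion_mul_conj {ι : Type*} [DecidableEq ι] {s : Finset ι} {e : ι → S2 → ℂ}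
    (he : ∀ i ∈ s, Continuous (e i))
    (ho : ∀ i ∈ s, ∀ j ∈ s, ∫ x, e i x * conj (e j x) ∂σ = if i = j then 1 else 0)
    (c : ι → ℂ) {j : ι} (hj : j ∈ s) :
    ∫ x, (∑ i ∈ s, c i * e i x) * conj (e j x) ∂σ = c j := by
  rw [integral_sum_mul_conj he c (he j hj), Finset.sum_congr rfl fun i hi => by rw [ho i hi j hj]]
  simp [hj]

theorem integral_norm_sq_expansion {ι : Type*} [DecidableEq ι] {s : Finset ι} {e : ι → S2 → ℂ}
    (he : ∀ i ∈ s, Continuous (e i))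
    (ho : ∀ i ∈ s, ∀ j ∈ s, ∫ x, e i x * conj (e j x) ∂σ = if i = j then 1 else 0)
    (c : ι → ℂ) : ∫ x, ‖∑ i ∈ s, c i * e i x‖ ^ 2 ∂σ = ∑ i ∈ s, ‖c i‖ ^ 2 := by
  have hg := continuous_sum_mul he c
  have h : ∫ x, (∑ i ∈ s, c i * e i x) * conj (∑ i ∈ s, c i * e i x) ∂σ =
      ∑ i ∈ s, c i * conj (c i) := by
    rw [integral_sum_mul_conj he c hg]
    refine Finset.sum_congr rfl fun j hj => ?_
    rw [← integral_expansion_mul_conj he ho c hj, ← integral_conj]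
    simp only [map_mul, Complex.conj_conj, mul_comm]
  have h2 : ∫ x, (∑ i ∈ s, c i * e i x) * conj (∑ i ∈ s, c i * e i x) ∂σ =
      ((∫ x, ‖∑ i ∈ s, c i * e i x‖ ^ 2 ∂σ : ℝ) : ℂ) := by
    rw [← integral_complex_ofReal]
    simp only [Complex.mul_conj']
    push_cast
    rfl
  rw [h2] at h
  simp only [Complex.mul_conj'] at h
  exact_mod_cast h

/-- The index set of the spherical harmonics of degree at most `L`. -/
def harmonicIndex (L : ℕ) : Finset (Σ _ : ℕ, ℤ) :=
  (Finset.range (L + 1)).sigma fun l => Finset.Icc (-(l : ℤ)) l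

theorem mem_harmonicIndex {L : ℕ} {i : Σ _ : ℕ, ℤ} :
    i ∈ harmonicIndex L ↔ i.1 ≤ L ∧ i.2 ∈ Set.Icc (-(i.1 : ℤ)) i.1 := by
  simp [harmonicIndex]

/-! ### Coefficients in an orthonormal basis of harmonics -/

section Basis

variable {L : ℕ} {Y : ℕ → ℤ → S2 → ℂ}

theorem IsOrthonormalHarmonicBasis.mem_harmonics (hY : IsOrthonormalHarmonicBasis L Y) {l : ℕ}
    (hl : l ≤ L) {m : ℤ} (hm : m ∈ Set.Icc (-(l : ℤ)) l) : Y l m ∈ harmonics l := by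
  rw [← hY.span_eq l hl]
  exact Submodule.subset_span ⟨m, hm, rfl⟩

theorem IsOrthonormalHarmonicBasis.continuous_index (hY : IsOrthonormalHarmonicBasis L Y) :
    ∀ i ∈ harmonicIndex L, Continuous (Y i.1 i.2) := fun _ hi =>
  continuous_of_mem_harmonics
    (hY.mem_harmonics (mem_harmonicIndex.1 hi).1 (mem_harmonicIndex.1 hi).2)

theorem IsOrthonormalHarmonicBasis.orthonormal_index (hY : IsOrthonormalHarmonicBasis L Y) :
    ∀ i ∈ harmonicIndex L, ∀ j ∈ harmonicIndex L,
      ∫ x, Y i.1 i.2 x * conj (Y j.1 j.2 x) ∂σ = if i = j then 1 else 0 := by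
  rintro ⟨l, m⟩ hi ⟨l', m'⟩ hj
  obtain ⟨h1, h2⟩ := mem_harmonicIndex.1 hi
  obtain ⟨h3, h4⟩ := mem_harmonicIndex.1 hj
  rw [hY.orthonormal l h1 m h2 l' h3 m' h4]
  simp

theorem exists_expansion (hY : IsOrthonormalHarmonicBasis L Y) {h : S2 → ℂ} (hh : h ∈ V L) :
    ∃ (p : ℕ → Poly) (c : (Σ _ : ℕ, ℤ) → ℂ), (∀ l, (p l).IsHomogeneous l) ∧
      (∀ l, polyLaplacian (p l) = 0) ∧
      (∀ x, h x = ∑ l ∈ Finset.range (L + 1), restrictToSphere (p l) x) ∧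
      ∀ l ≤ L, ∀ x, restrictToSphere (p l) x =
        ∑ m ∈ Finset.Icc (-(l : ℤ)) l, c ⟨l, m⟩ * Y l m x := by
  obtain ⟨μ, hμ⟩ := (Submodule.mem_iSup_finset_iff_exists_sum _ _).1 hh
  choose p hp hp0 hpr using fun l => exists_poly_of_mem_harmonics (μ l).2
  have hc : ∀ l, ∃ c : ℤ → ℂ, l ≤ L →
      ∑ m ∈ Finset.Icc (-(l : ℤ)) l, c m • Y l m = (μ l : S2 → ℂ) := by
    intro l
    by_cases hl : l ≤ L
    · have hmem := (hY.span_eq l hl).ge (μ l).2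
      rw [← Finset.coe_Icc, Submodule.mem_span_image_finset_iff_exists_fun'] at hmem
      obtain ⟨c, hc⟩ := hmem
      exact ⟨c, fun _ => hc⟩
    · exact ⟨0, fun h => absurd h hl⟩
  choose c hc using hc
  refine ⟨p, fun i => c i.1 i.2, hp, hp0, fun x => ?_, fun l hl x => ?_⟩
  · rw [← hμ, Finset.sum_apply]
    simp only [hpr]
  · rw [hpr, ← hc l hl, Finset.sum_apply]
    rfl

theorem sum_harmonicIndex {E : Type*} [AddCommMonoid E] (F : ℕ → ℤ → E) :
    ∑ i ∈ harmonicIndex L, F i.1 i.2 =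
      ∑ l ∈ Finset.range (L + 1), ∑ m ∈ Finset.Icc (-(l : ℤ)) l, F l m := by
  rw [harmonicIndex, Finset.sum_sigma]

theorem continuous_of_coe_mem_V {f : S2 → ℝ} (hf : (fun x => (f x : ℂ)) ∈ V L) :
    Continuous f := by
  have h := Complex.continuous_re.comp (continuous_of_mem_V hf)
  simpa [Function.comp_def] using h

/-- The expansion of a real function in `V L`, with the coefficients `coeff Y f`. -/
theorem exists_real_expansion (hY : IsOrthonormalHarmonicBasis L Y) {f : S2 → ℝ}
    (hf : (fun x => (f x : ℂ)) ∈ V L) :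
    ∃ p : ℕ → Poly, (∀ l, (p l).IsHomogeneous l) ∧ (∀ l, polyLaplacian (p l) = 0) ∧
      (∀ x, (f x : ℂ) = ∑ l ∈ Finset.range (L + 1), restrictToSphere (p l) x) ∧
      ∀ l ≤ L, ∀ x, restrictToSphere (p l) x =
        ∑ m ∈ Finset.Icc (-(l : ℤ)) l, conj (coeff Y f l m) * Y l m x := by
  obtain ⟨p, c, hp, hp0, hs, hc⟩ := exists_expansion hY hf
  refine ⟨p, hp, hp0, hs, fun l hl x => ?_⟩
  rw [hc l hl]
  refine Finset.sum_congr rfl fun m hm => ?_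
  have hi : (⟨l, m⟩ : Σ _ : ℕ, ℤ) ∈ harmonicIndex L :=
    mem_harmonicIndex.2 ⟨hl, Finset.mem_Icc.1 hm⟩
  have hexp : ∀ x, (f x : ℂ) = ∑ i ∈ harmonicIndex L, c i * Y i.1 i.2 x := by
    intro x
    rw [hs, harmonicIndex, Finset.sum_sigma]
    exact Finset.sum_congr rfl fun l hl => hc l (Nat.lt_succ_iff.1 (Finset.mem_range.1 hl)) x
  have h := integral_expansion_mul_conj hY.continuous_index hY.orthonormal_index c hi
  -- `coeff` pairs `f` with `Y`, not with its conjugate; since `f` is real, the true expansion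
  -- coefficient is the conjugate of `coeff`.
  rw [← h, coeff, ← integral_conj]
  simp only [← hexp, map_mul, Complex.conj_ofReal]

theorem parseval (hY : IsOrthonormalHarmonicBasis L Y) {f : S2 → ℝ}
    (hf : (fun x => (f x : ℂ)) ∈ V L) : coeffSq L (coeff Y f) = ∫ x, f x ^ 2 ∂σ := by
  obtain ⟨p, -, -, hs, hc⟩ := exists_real_expansion hY hf
  have h := integral_norm_sq_expansion hY.continuous_index hY.orthonormal_index
    fun i => conj (coeff Y f i.1 i.2)
  rw [coeffSq, ← sum_harmonicIndex fun l m => ‖coeff Y f l m‖ ^ 2]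
  simp only [RCLike.norm_conj] at h
  rw [← h]
  congr 1
  ext x
  have hexp : ∑ i ∈ harmonicIndex L, conj (coeff Y f i.1 i.2) * Y i.1 i.2 x = (f x : ℂ) := by
    rw [hs, harmonicIndex, Finset.sum_sigma]
    exact Finset.sum_congr rfl fun l hl =>
      (hc l (Nat.lt_succ_iff.1 (Finset.mem_range.1 hl)) x).symm
  rw [hexp, Complex.norm_real, Real.norm_eq_abs, sq_abs]

theorem L2norm_sq (f : S2 → ℝ) : L2norm f ^ 2 = ∫ x, f x ^ 2 ∂σ :=
  Real.sq_sqrt (integral_nonneg fun _ => sq_nonneg _)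

theorem L2norm_nonneg (f : S2 → ℝ) : 0 ≤ L2norm f := Real.sqrt_nonneg _

theorem C2norm_nonneg (f : S2 → ℝ) : 0 ≤ C2norm f :=
  (Real.iSup_nonneg fun x => abs_nonneg (f x)).trans (le_max_left _ _)

/-- Parseval for `-Δf`, then the pointwise bound `2 * C2norm f` on a sphere of area `4π`. -/
theorem sum_eigenvalue_sq_le (hY : IsOrthonormalHarmonicBasis L Y) {f : S2 → ℝ}
    (hf : (fun x => (f x : ℂ)) ∈ V L) :
    ∑ i ∈ harmonicIndex L, ((i.1 * (i.1 + 1) : ℝ) * ‖coeff Y f i.1 i.2‖) ^ 2 ≤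
      (2 * C2norm f) ^ 2 * (4 * Real.pi) := by
  obtain ⟨p, hp, hp0, hs, hc⟩ := exists_real_expansion hY hf
  have h := integral_norm_sq_expansion hY.continuous_index hY.orthonormal_index
    fun i => ((i.1 : ℂ) * (i.1 + 1)) * conj (coeff Y f i.1 i.2)
  have hnorm : ∀ i : Σ _ : ℕ, ℤ, ‖((i.1 : ℂ) * (i.1 + 1)) * conj (coeff Y f i.1 i.2)‖ =
      (i.1 * (i.1 + 1) : ℝ) * ‖coeff Y f i.1 i.2‖ := by
    intro i
    rw [norm_mul, RCLike.norm_conj, norm_mul, Complex.norm_natCast]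
    congr 2
    exact_mod_cast Complex.norm_natCast (i.1 + 1)
  simp only [hnorm] at h
  rw [← h]
  have hexp : ∀ x, ∑ i ∈ harmonicIndex L, ((i.1 : ℂ) * (i.1 + 1)) * conj (coeff Y f i.1 i.2) *
      Y i.1 i.2 x = ∑ l ∈ Finset.range (L + 1), ((l : ℂ) * (l + 1)) * restrictToSphere (p l) x := by
    intro x
    rw [harmonicIndex, Finset.sum_sigma]
    refine Finset.sum_congr rfl fun l hl => ?_
    rw [hc l (Nat.lt_succ_iff.1 (Finset.mem_range.1 hl)) x, Finset.mul_sum]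
    exact Finset.sum_congr rfl fun m _ => mul_assoc _ _ _
  simp only [hexp]
  have hle := norm_integral_le_of_norm_le_const (μ := σ) (C := (2 * C2norm f) ^ 2)
    (f := fun x => ‖∑ l ∈ Finset.range (L + 1), ((l : ℂ) * (l + 1)) * restrictToSphere (p l) x‖ ^ 2)
    (Filter.Eventually.of_forall fun x => by
      rw [norm_pow, norm_norm]
      exact pow_le_pow_left₀ (norm_nonneg _) (norm_sum_eigenvalue_le hp hp0 hs x) 2)
  rw [sigma_univ] at hle
  exact (Real.le_norm_self _).trans hle

theorem sum_inv_eigenvalue_sq_le (L : ℕ) :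
    ∑ i ∈ harmonicIndex L, (((i.1 : ℝ) * (i.1 + 1))⁻¹) ^ 2 ≤ 1 := by
  rw [sum_harmonicIndex fun l _ => (((l : ℝ) * (l + 1))⁻¹) ^ 2]
  have hcard : ∀ l : ℕ, (Finset.Icc (-(l : ℤ)) l).card = 2 * l + 1 := by
    intro l
    rw [Int.card_Icc]
    omega
  simp only [Finset.sum_const, hcard, nsmul_eq_mul]
  -- Telescoping: `(2l+1)/(l(l+1))² = 1/l² - 1/(l+1)²` for `l ≥ 1`. The term `l = 0` vanishes
  -- because `0⁻¹ = 0`.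
  have h : ∀ n : ℕ, ∑ l ∈ Finset.range (n + 1), ((2 * l + 1 : ℕ) : ℝ) *
      (((l : ℝ) * (l + 1))⁻¹) ^ 2 ≤ 1 - (((n : ℝ) + 1) ^ 2)⁻¹ := by
    intro n
    induction n with
    | zero => simp
    | succ n ih =>
      rw [Finset.sum_range_succ]
      refine (add_le_add_left ih _).trans (le_of_eq ?_)
      push_cast
      have h1 : (n : ℝ) + 1 ≠ 0 := by positivity
      have h2 : (n : ℝ) + 1 + 1 ≠ 0 := by positivity
      field_simp
      ring
  refine (h L).trans ?_
  have : 0 ≤ (((L : ℝ) + 1) ^ 2)⁻¹ := by positivity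
  linarith

theorem norm_coeff_zero_le (hY : IsOrthonormalHarmonicBasis L Y) (f : S2 → ℝ) :
    ‖coeff Y f 0 0‖ ≤ |∫ x, f x ∂σ| := by
  have h0 : (0 : ℤ) ∈ Set.Icc (-((0 : ℕ) : ℤ)) (0 : ℕ) := by simp
  obtain ⟨p, hp, -, hpr⟩ := exists_poly_of_mem_harmonics (hY.mem_harmonics (Nat.zero_le L) h0)
  rw [← MvPolynomial.totalDegree_zero_iff_isHomogeneous,
    MvPolynomial.totalDegree_eq_zero_iff_eq_C] at hp
  set k := p.coeff 0
  have hk : ∀ x, Y 0 0 x = k := by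
    intro x
    rw [← hpr, restrictToSphere_apply, hp, evalAt_C]
  have hn := hY.orthonormal 0 (Nat.zero_le L) 0 h0 0 (Nat.zero_le L) 0 h0
  simp only [hk, integral_const, sigma_univ, Complex.mul_conj', and_self, if_true] at hn
  rw [Complex.real_smul] at hn
  -- Normalization forces `‖k‖ = 1/√(4π)`; the cruder `‖k‖ ≤ 1` is enough.
  have hn' : 4 * Real.pi * ‖k‖ ^ 2 = 1 := by exact_mod_cast hn
  have hk1 : ‖k‖ ≤ 1 := by
    have := Real.pi_gt_three
    by_contra hlt
    rw [not_le] at hlt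
    nlinarith [sq_nonneg (‖k‖ - 1)]
  simp only [coeff, hk]
  rw [integral_mul_const, integral_complex_ofReal, norm_mul, Complex.norm_real, Real.norm_eq_abs]
  exact mul_le_of_le_one_right (abs_nonneg _) hk1

theorem coeffL1_le (hY : IsOrthonormalHarmonicBasis L Y) {f : S2 → ℝ}
    (hf : (fun x => (f x : ℂ)) ∈ V L) :
    coeffL1 L (coeff Y f) ≤ |∫ x, f x ∂σ| + 4 * √Real.pi * C2norm f := by
  -- Inserting the weight and its inverse changes nothing for `l ≥ 1` and annihilates `l = 0`, which
  -- is why that coefficient is split off.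
  have h1 : coeffL1 L (coeff Y f) = ‖coeff Y f 0 0‖ + ∑ i ∈ harmonicIndex L,
      ((i.1 : ℝ) * (i.1 + 1))⁻¹ * ((i.1 * (i.1 + 1) : ℝ) * ‖coeff Y f i.1 i.2‖) := by
    rw [sum_harmonicIndex fun l m => ((l : ℝ) * (l + 1))⁻¹ * ((l * (l + 1) : ℝ) * ‖coeff Y f l m‖),
      coeffL1, Finset.sum_range_succ', Finset.sum_range_succ', add_comm]
    have h2 : ∀ l : ℕ, ∀ m : ℤ, (((l + 1 : ℕ) : ℝ) * ((l + 1 : ℕ) + 1))⁻¹ *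
        ((((l + 1 : ℕ) : ℝ) * ((l + 1 : ℕ) + 1)) * ‖coeff Y f (l + 1) m‖) =
        ‖coeff Y f (l + 1) m‖ := fun l m => inv_mul_cancel_left₀ (by positivity) _
    simp only [h2]
    simp
  rw [h1]
  refine add_le_add (norm_coeff_zero_le hY f) ((Real.sum_mul_le_sqrt_mul_sqrt _ _ _).trans ?_)
  have h3 : √((2 * C2norm f) ^ 2 * (4 * Real.pi)) = 4 * √Real.pi * C2norm f := by
    rw [show (2 * C2norm f) ^ 2 * (4 * Real.pi) = (4 * C2norm f) ^ 2 * Real.pi by ring,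
      Real.sqrt_mul (sq_nonneg _), Real.sqrt_sq (by linarith [C2norm_nonneg f])]
    ring
  rw [← h3, ← one_mul (√((2 * C2norm f) ^ 2 * (4 * Real.pi)))]
  refine mul_le_mul ?_ (Real.sqrt_le_sqrt (sum_eigenvalue_sq_le hY hf)) (Real.sqrt_nonneg _)
    zero_le_one
  exact Real.sqrt_le_one.2 (sum_inv_eigenvalue_sq_le L)

theorem fourierRatio_le (hL : 1 ≤ L) (hY : IsOrthonormalHarmonicBasis L Y) {f : S2 → ℝ}
    (hf : (fun x => (f x : ℂ)) ∈ V L) :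
    fourierRatio L (coeff Y f) ≤ |∫ x, f x ∂σ| / L2norm f
      + 48 * √Real.pi * (C2norm f / L2norm f) * Real.log L
      + 48 * √Real.pi * (C2norm f / L2norm f) * (1 / L) := by
  -- This is `log x ≥ 1 - 1/x`. It absorbs the bound `4√π · C2norm f`, with room to spare in the
  -- constant `48`.
  have hlog : 1 ≤ Real.log L + 1 / L := by
    have := Real.one_sub_inv_le_log_of_pos (show (0 : ℝ) < L by exact_mod_cast hL)
    rw [one_div]
    linarith
  have hC : 0 ≤ √Real.pi * C2norm f := mul_nonneg (Real.sqrt_nonneg _) (C2norm_nonneg f)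
  have hden : √(coeffSq L (coeff Y f)) = L2norm f := by rw [parseval hY hf, L2norm]
  rw [fourierRatio, hden]
  have h1 : |∫ x, f x ∂σ| / L2norm f + 48 * √Real.pi * (C2norm f / L2norm f) * Real.log L
      + 48 * √Real.pi * (C2norm f / L2norm f) * (1 / L) =
      (|∫ x, f x ∂σ| + 48 * (√Real.pi * C2norm f) * (Real.log L + 1 / L)) / L2norm f := by
    ring
  rw [h1]
  refine div_le_div_of_nonneg_right ((coeffL1_le hY hf).trans ?_) (L2norm_nonneg f)
  nlinarith [mul_le_mul_of_nonneg_left hlog hC]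

end Basis

/-- Cauchy–Schwarz against the constant `1`, in the form that the variance of `f` about its mean is
nonnegative. -/
theorem integral_le_L2norm {f : S2 → ℝ} (hf : Continuous f) :
    ∫ x, f x ∂σ ≤ √(4 * Real.pi) * L2norm f := by
  have hi : ∀ {g : S2 → ℝ}, Continuous g → Integrable g σ := fun {g} hg =>
    hg.integrable_of_hasCompactSupport (HasCompactSupport.of_compactSpace g)
  set μ := ∫ x, f x ∂σ with hμ
  have hpi := Real.pi_pos
  have h : 0 ≤ ∫ x, (f x - μ / (4 * Real.pi)) ^ 2 ∂σ := integral_nonneg fun _ => sq_nonneg _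
  have h2 : ∫ x, (f x - μ / (4 * Real.pi)) ^ 2 ∂σ = L2norm f ^ 2 - μ ^ 2 / (4 * Real.pi) := by
    have h3 : ∀ x, (f x - μ / (4 * Real.pi)) ^ 2 =
        f x ^ 2 - (2 * (μ / (4 * Real.pi)) * f x - (μ / (4 * Real.pi)) ^ 2) := fun x => by ring
    have i1 : Integrable (fun x => f x ^ 2) σ := hi (by fun_prop)
    have i2 : Integrable (fun x => 2 * (μ / (4 * Real.pi)) * f x) σ := hi (by fun_prop)
    have i3 : Integrable (fun _ : S2 => (μ / (4 * Real.pi)) ^ 2) σ := hi continuous_const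
    have i4 : Integrable (fun x => 2 * (μ / (4 * Real.pi)) * f x - (μ / (4 * Real.pi)) ^ 2) σ :=
      i2.sub i3
    simp only [h3]
    rw [integral_sub i1 i4, integral_sub i2 i3, integral_const_mul, integral_const, sigma_univ, ← hμ, L2norm_sq,
      smul_eq_mul]
    field_simp
    ring
  rw [h2, sub_nonneg, div_le_iff₀ (by positivity)] at h
  refine le_of_abs_le (abs_le_of_sq_le_sq ?_ (mul_nonneg (Real.sqrt_nonneg _) (L2norm_nonneg f)))
  rw [mul_pow, Real.sq_sqrt (by positivity)]
  linarith

end SphereFR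

end

/-! ### The main theorem -/

open SphereFR
theorem proposition1p12 (L : ℕ) (hL : 1 ≤ L)
    (f : S2 → ℝ) (hfV : (fun x => (f x : ℂ)) ∈ V L) (hfC : ContMDiff (𝓡 2) 𝓘(ℝ, ℝ) 2 f)
    (M : ℕ) (ω : Fin M → S2) (w : Fin M → ℝ)
    (hquad : ∀ P ∈ V (2 * L), ∫ x, P x ∂σ = ∑ j, (w j : ℂ) * P (ω j))
    (g : Fin M → ℝ) (hg : ∀ j, g j = f (ω j)) :
    IsOrthonormalHarmonicBasis L standardY ∧
    ∀ Y : ℕ → ℤ → S2 → ℂ, IsOrthonormalHarmonicBasis L Y →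
      -- products with the basis functions, and equality of the coefficients
      (∀ l ≤ L, ∀ m ∈ Set.Icc (-(l : ℤ)) l, (fun x => (f x : ℂ) * Y l m x) ∈ V (2 * L)) ∧
      (∀ l ≤ L, ∀ m ∈ Set.Icc (-(l : ℤ)) l, discreteCoeff Y ω w g l m = coeff Y f l m) ∧
      -- Parseval and the discrete energy
      coeffSq L (discreteCoeff Y ω w g) = coeffSq L (coeff Y f) ∧
      coeffSq L (coeff Y f) = L2norm f ^ 2 ∧
      ∑ j, w j * |g j| ^ 2 = L2norm f ^ 2 ∧
      -- the Fourier ratios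
      (f ≠ 0 →
        fourierRatio L (coeff Y f) = fourierRatio L (discreteCoeff Y ω w g) ∧
        fourierRatio L (coeff Y f) ≤
          |∫ x, f x ∂σ| / L2norm f
            + 48 * √Real.pi * (C2norm f / L2norm f) * Real.log L
            + 48 * √Real.pi * (C2norm f / L2norm f) * (1 / L)) ∧
      -- the variant for nonnegative functions
      ((∀ x, 0 ≤ f x) → ∀ μ : ℝ, μ = ∫ x, f x ∂σ → 0 < μ →
        fourierRatio L (coeff Y f) ≤
          √(4 * Real.pi)
            + 48 * √Real.pi * √(4 * Real.pi) * (C2norm f / μ) * Real.log L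
            + 48 * √Real.pi * √(4 * Real.pi) * (C2norm f / μ) * (1 / L)) := by
  have hf : Continuous f := continuous_of_coe_mem_V hfV
  refine ⟨isOrthonormalHarmonicBasis_standardY L, fun Y hY => ?_⟩
  have hmul : ∀ l ≤ L, ∀ m ∈ Set.Icc (-(l : ℤ)) l, (fun x => (f x : ℂ) * Y l m x) ∈ V (2 * L) :=
    fun l hl m hm => mul_mem_V hfV (harmonics_le_V hl (hY.mem_harmonics hl hm))
  have hcoeff : ∀ l ≤ L, ∀ m ∈ Set.Icc (-(l : ℤ)) l,
      discreteCoeff Y ω w g l m = coeff Y f l m := by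
    intro l hl m hm
    rw [coeff, hquad _ (hmul l hl m hm), discreteCoeff]
    exact Finset.sum_congr rfl fun j _ => by rw [hg, mul_assoc]
  have hsum : ∀ F : ℂ → ℝ, ∑ l ∈ Finset.range (L + 1), ∑ m ∈ Finset.Icc (-(l : ℤ)) l,
      F (discreteCoeff Y ω w g l m) = ∑ l ∈ Finset.range (L + 1), ∑ m ∈ Finset.Icc (-(l : ℤ)) l,
      F (coeff Y f l m) := fun F =>
    Finset.sum_congr rfl fun l hl => Finset.sum_congr rfl fun m hm => by
      rw [hcoeff l (Nat.lt_succ_iff.1 (Finset.mem_range.1 hl)) m (Finset.mem_Icc.1 hm)]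
  have hsq : coeffSq L (discreteCoeff Y ω w g) = coeffSq L (coeff Y f) := hsum fun z => ‖z‖ ^ 2
  have hL1 : coeffL1 L (discreteCoeff Y ω w g) = coeffL1 L (coeff Y f) := hsum fun z => ‖z‖
  refine ⟨hmul, hcoeff, hsq, by rw [parseval hY hfV, L2norm_sq], ?_, fun _ => ⟨?_, ?_⟩, ?_⟩
  -- The quadrature is exact on `f²`, a product of two elements of `V L`.
  · have h := hquad _ (mul_mem_V hfV hfV)
    have h1 : ((∑ j, w j * |g j| ^ 2 : ℝ) : ℂ) = ((∫ x, f x ^ 2 ∂σ : ℝ) : ℂ) := by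
      rw [← integral_complex_ofReal]
      push_cast
      simp only [pow_two] at h ⊢
      rw [h]
      refine Finset.sum_congr rfl fun j _ => ?_
      rw [← Complex.ofReal_mul, abs_mul_abs_self, hg, Complex.ofReal_mul]
    rw [L2norm_sq]
    exact_mod_cast h1
  · rw [fourierRatio, fourierRatio, hsq, hL1]
  · exact fourierRatio_le hL hY hfV
  · rintro - μ hμ hpos
    have hle := integral_le_L2norm hf
    rw [← hμ] at hle
    have hN : 0 < L2norm f := by
      refine lt_of_le_of_ne (L2norm_nonneg f) fun h => ?_
      rw [← h, mul_zero] at hle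
      exact hle.not_gt hpos
    have h1 : |∫ x, f x ∂σ| / L2norm f ≤ √(4 * Real.pi) := by
      rw [← hμ, abs_of_pos hpos, div_le_iff₀ hN]
      exact hle
    -- The inequality `μ ≤ √(4π) ‖f‖₂` also bounds `1/‖f‖₂` by `√(4π)/μ`.
    have h2 : C2norm f / L2norm f ≤ √(4 * Real.pi) * (C2norm f / μ) := by
      rw [div_le_iff₀ hN, mul_right_comm, ← mul_div_assoc, le_div_iff₀ hpos, mul_comm]
      exact mul_le_mul_of_nonneg_right hle (C2norm_nonneg f)
    have hlog : 0 ≤ Real.log L := Real.log_natCast_nonneg L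
    refine (fourierRatio_le hL hY hfV).trans ?_
    rw [mul_assoc (48 * √Real.pi) (√(4 * Real.pi))]
    gcongr
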